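/- Let $\mathbb E,\mathbb H$ be finite-dimensional real linear spaces with duals $\mathbb E^*,\mathbb H^*$, let $K\subset\mathbb E$ be a regular cone (closed, convex, pointed, with nonempty interior), $K^*\subset\mathbb E^*$ its dual cone, and let $F$ be a $\nu$-normal barrier for $K$: a closed convex $C^3$ self-concordant function on $\operatorname{int}K$ with $F(\tau x)=F(x)-\nu\ln\tau$ for all $x\in\operatorname{int}K$, $\tau>0$. Let $F_*(s)=\max_{x\in\operatorname{int}K}\{-\langle s,x\rangle-F(x)\}$ be the dual barrier. Let $A:\mathbb E\to\mathbb H^*$ be linear and surjective, $b\in\mathbb H^*$, $c\in\mathbb E^*$, and consider the problems $\min\{\langle c,x\rangle: Ax=b,\ x\in K\}$ and $\max\{\langle b,y\rangle: s+A^*y=c,\ s\in K^*,\ y\in\mathbb H\}$, assumed strictly feasible: there are $x_0\in\operatorname{int}K$, $s_0\in\operatorname{int}K^*$, $y_0\in\mathbb H$ with $Ax_0=b$, $s_0+A^*y_0=c$. Put $s(y)=c-A^*y$, $Q=\{y\in\mathbb H: s(y)\in K^*\}$, $f(y)=F_*(s(y))$ for $y\in\operatorname{int}Q$, $f^*=\max_{y\in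 Q}\langle b,y\rangle$. Let $(x_\mu,s_\mu,y_\mu)$, $\mu>0$, be the primal-dual central path, given by $x_\mu\in\operatorname{int}K$, $Ax_\mu=b$, $c+\mu\nabla F(x_\mu)=A^*y_\mu$, $s_\mu=-\mu\nabla F(x_\mu)$. Put $B=\nabla^2F(x_1):\mathbb E\to\mathbb E^*$ and $G=AB^{-1}A^*:\mathbb H\to\mathbb H^*$, with $\|x\|_B=\langle Bx,x\rangle^{1/2}$ and $\|y\|_G=\langle Gy,y\rangle^{1/2}$. Let $(s_*,y_*)$ be an optimal solution of the dual problem. Assume that there are constants $\gamma_d>0$ and $\sigma_d$ such that 1. (sharp dual maximum) $f^*-\langle b,y\rangle\ge\gamma_d\|y-y_*\|_G$ for every $y\in Q$; 2. $\|\nabla^2F_*(s_\mu)s_*\|_B\le\sigma_d$ for every $\mu\in(0,1]$. Let $\mu\in(0,1]$, $\beta\in[0,\tfrac19]$ and let $y$ belong to the neighborhood $$\mathcal N(\mu,\beta)=\Bigl\{y\in\operatorname{int}Q:\ \bigl\langle g,[\nabla^2f(y)]^{-1}g\bigr\rangle^{1/2}\le\beta,\ \ g=\nabla f(y)-\tfrac1\mu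 b\Bigr\}.$$ Then $\nabla^2 f(y)$ is invertible, and the predicted point $p(y)=y+[\nabla^2f(y)]^{-1}\nabla f(y)$ satisfies $$\|p(y)-y_*\|_G\ \le\ \frac{4}{\gamma_d^2}\Bigl(\sigma_d+\frac{6\nu^2}{\mu}\beta\Bigr)\langle b,y-y_*\rangle^2\ \le\ \frac{4\nu}{\gamma_d^2}\Bigl(\sigma_d+\frac{6\nu^2}{\mu}\beta\Bigr)\|y-y_*\|_G^2 .$$ -/

import Mathlib

open Set Filter Topology

noncomputable section

namespace ConicIPM

/-! ### Derivatives and Euclidean norms -/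

section General

variable {V : Type*} [NormedAddCommGroup V] [NormedSpace ℝ V]

/-- The gradient `∇Φ(x)`, an element of the dual space. -/
def grad (Φ : V → ℝ) (x : V) : StrongDual ℝ V := fderiv ℝ Φ x

/-- The Hessian `∇²Φ(x)`, an operator from the space to its dual. -/
def hess (Φ : V → ℝ) (x : V) : V →L[ℝ] StrongDual ℝ V := fderiv ℝ (grad Φ) x

/-- The third differential `∇³Φ(x)[h, h, h]`. -/
def third (Φ : V → ℝ) (x h : V) : ℝ := fderiv ℝ (hess Φ) x h h h

/-- The norm `‖x‖_B = ⟨B x, x⟩^{1/2}` of a vector. -/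
def primalNorm (B : V →L[ℝ] StrongDual ℝ V) (x : V) : ℝ := √(B x x)

/-- The norm `‖s‖_B = ⟨s, B⁻¹ s⟩^{1/2}` of a linear function. -/
def dualNorm (B : V →L[ℝ] StrongDual ℝ V) (s : StrongDual ℝ V) : ℝ := √(s (B.inverse s))

/-- `Φ` is a (closed) self-concordant function on the interior of the convex set `Q`. Closedness
of the convex function `Φ` with open domain is expressed by `Φ → +∞` at the boundary. -/
structure IsSelfConcordant (Q : Set V) (Φ : V → ℝ) : Prop where
  contDiffOn : ContDiffOn ℝ 3 Φ (interior Q)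
  convexOn : ConvexOn ℝ (interior Q) Φ
  tendsto_frontier : ∀ x ∈ frontier Q, Tendsto Φ (𝓝[interior Q] x) atTop
  third_le : ∀ x ∈ interior Q, ∀ h : V, |third Φ x h| ≤ 2 * (hess Φ x h h) ^ (3 / 2 : ℝ)

/-- `F` is a `ν`-normal barrier for the cone `K`: self-concordant and `ν`-logarithmically
homogeneous. -/
structure IsNormalBarrier (K : ProperCone ℝ V) (ν : ℝ) (F : V → ℝ) : Prop where
  selfConcordant : IsSelfConcordant (K : Set V) F
  logHomogeneous : ∀ x ∈ interior (K : Set V), ∀ τ : ℝ, 0 < τ → F (τ • x) = F x - ν * Real.log τ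

/-- A regular cone: closed and convex (as a `ProperCone`), containing no line, with nonempty
interior. -/
structure IsRegularCone (K : ProperCone ℝ V) : Prop where
  salient : ∀ x ∈ K, -x ∈ K → x = 0
  interior_nonempty : (interior (K : Set V)).Nonempty

/-- The dual cone `K^* = {s : ⟨s, x⟩ ≥ 0 for all x ∈ K}`. -/
def dualCone (K : ProperCone ℝ V) : Set (StrongDual ℝ V) := {s | ∀ x ∈ K, 0 ≤ s x}

/-- The dual barrier `F_*(s) = max_{x ∈ int K} {-⟨s, x⟩ - F(x)}`. -/
def dualBarrier (K : ProperCone ℝ V) (F : V → ℝ) (s : StrongDual ℝ V) : ℝ :=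
  sSup ((fun x : V => -(s x) - F x) '' interior (K : Set V))

end General

section Bidual

variable (E : Type*) [NormedAddCommGroup E] [NormedSpace ℝ E] [FiniteDimensional ℝ E]

/-- The canonical identification `x ↦ (s ↦ ⟨s, x⟩)` of a finite-dimensional space with its
bidual. -/
def bidualEquiv : E ≃L[ℝ] StrongDual ℝ (StrongDual ℝ E) :=
  (LinearEquiv.ofInjectiveOfFinrankEq
    (NormedSpace.inclusionInDoubleDual ℝ E : E →ₗ[ℝ] StrongDual ℝ (StrongDual ℝ E))
    (NormedSpace.inclusionInDoubleDualLi (E := E) ℝ).injective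
    (by
      have h1 : ∀ (W : Type _) [NormedAddCommGroup W] [NormedSpace ℝ W] [FiniteDimensional ℝ W],
          Module.finrank ℝ (StrongDual ℝ W) = Module.finrank ℝ W := fun W _ _ _ => by
        rw [← (LinearMap.toContinuousLinearMap (𝕜 := ℝ) (E := W) (F' := ℝ)).finrank_eq]
        exact Subspace.dual_finrank_eq
      rw [h1, h1])).toContinuousLinearEquiv

theorem bidualEquiv_apply (x : E) (s : StrongDual ℝ E) : bidualEquiv E x s = s x := rfl

variable {E}

/-- The Hessian of a function on the dual space, as an operator `∇²Φ(s) : E^* → E`, through the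
identification of `E` with its bidual. -/
def hessDual (Φ : StrongDual ℝ E → ℝ) (s : StrongDual ℝ E) : StrongDual ℝ E →L[ℝ] E :=
  ((bidualEquiv E).symm : StrongDual ℝ (StrongDual ℝ E) →L[ℝ] E).comp (hess Φ s)

end Bidual

/-! ### The primal-dual pair of conic problems -/

/-- The data of the primal problem `min {⟨c, x⟩ : A x = b, x ∈ K}` and of the dual problem
`max {⟨b, y⟩ : s + A^* y = c, s ∈ K^*}`, with a function `F` on `E` (the barrier of `K`). -/
structure Problem (E H : Type*) [NormedAddCommGroup E] [NormedSpace ℝ E]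
    [NormedAddCommGroup H] [NormedSpace ℝ H] where
  K : ProperCone ℝ E
  A : E →L[ℝ] StrongDual ℝ H
  b : StrongDual ℝ H
  c : StrongDual ℝ E
  F : E → ℝ

namespace Problem

variable {E H : Type*} [NormedAddCommGroup E] [NormedSpace ℝ E]
  [NormedAddCommGroup H] [NormedSpace ℝ H]

/-- The adjoint operator `A^* : H → E^*`, `⟨A^* y, x⟩ = ⟨A x, y⟩`. -/
def adj (P : Problem E H) : H →L[ℝ] StrongDual ℝ E := P.A.flip

/-- The slack `s(y) = c - A^* y`. -/
def slack (P : Problem E H) (y : H) : StrongDual ℝ E := P.c - P.adj y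

/-- The feasible set `Q = {y : c - A^* y ∈ K^*}` of the dual problem. -/
def Q (P : Problem E H) : Set H := {y | P.slack y ∈ dualCone P.K}

/-- The optimal value `f^*` of the dual problem. -/
def fStar (P : Problem E H) : ℝ := sSup (P.b '' P.Q)

/-- Strict feasibility of both problems. -/
def StrictlyFeasible (P : Problem E H) : Prop :=
  (∃ x₀ ∈ interior (P.K : Set E), P.A x₀ = P.b) ∧
    ∃ s₀ ∈ interior (dualCone P.K), ∃ y₀ : H, s₀ + P.adj y₀ = P.c

/-- `(s, y)` is an optimal solution of the dual problem. -/
def IsDualOptimal (P : Problem E H) (sStar : StrongDual ℝ E) (yStar : H) : Prop :=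
  (sStar ∈ dualCone P.K ∧ sStar + P.adj yStar = P.c) ∧
    ∀ s ∈ dualCone P.K, ∀ y : H, s + P.adj y = P.c → P.b y ≤ P.b yStar

/-- The dual barrier `F_*` of the cone `K^*`. -/
def FStar (P : Problem E H) : StrongDual ℝ E → ℝ := dualBarrier P.K P.F

/-- The barrier `f(y) = F_*(c - A^* y)` of the set `Q`. -/
def f (P : Problem E H) (y : H) : ℝ := P.FStar (P.slack y)

/-- `z = (x, s, y)` is the point of the primal-dual central path with parameter `μ`. -/
def IsCentralPoint (P : Problem E H) (μ : ℝ) (z : E × StrongDual ℝ E × H) : Prop :=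
  z.1 ∈ interior (P.K : Set E) ∧ P.A z.1 = P.b ∧
    P.c + μ • grad P.F z.1 = P.adj z.2.2 ∧ z.2.1 = -(μ • grad P.F z.1)

/-- The primal-dual central path `μ ↦ z_μ = (x_μ, s_μ, y_μ)`, `μ > 0`. (Under strict feasibility,
for a normal barrier of a regular cone and a surjective `A`, the point is determined uniquely by
`IsCentralPoint`.) -/
def centralPath (P : Problem E H) (μ : ℝ) : E × StrongDual ℝ E × H :=
  Classical.epsilon (P.IsCentralPoint μ)

/-- The operator `B = ∇²F(x_1)`. -/
def B (P : Problem E H) : E →L[ℝ] StrongDual ℝ E := hess P.F (P.centralPath 1).1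

/-- The operator `G = A B⁻¹ A^* : H → H^*`. -/
def G (P : Problem E H) : H →L[ℝ] StrongDual ℝ H := P.A.comp (P.B.inverse.comp P.adj)

/-- The sharp dual maximum condition with constant `γ`:
`f^* - ⟨b, y⟩ ≥ γ ‖y - y_*‖_G` for every `y ∈ Q`. -/
def SharpDual (P : Problem E H) (yStar : H) (γ : ℝ) : Prop :=
  0 < γ ∧ ∀ y ∈ P.Q, γ * primalNorm P.G (y - yStar) ≤ P.fStar - P.b y

/-- The boundedness of `∇²F_*(s_μ) s_*` along the central path with constant `σ`:
`‖∇²F_*(s_μ) s_*‖_B ≤ σ` for every `μ ∈ (0, 1]`. -/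
def BoundedAlongPath [FiniteDimensional ℝ E] (P : Problem E H) (sStar : StrongDual ℝ E)
    (σ : ℝ) : Prop :=
  ∀ μ ∈ Ioc (0 : ℝ) 1, primalNorm P.B (hessDual P.FStar (P.centralPath μ).2.1 sStar) ≤ σ

/-- The local gradient proximity measure `γ(y, μ) = ‖∇f(y) - b/μ‖_y`, in the local norm
`‖s‖_y = ⟨s, [∇²f(y)]⁻¹ s⟩^{1/2}`. -/
def proximity (P : Problem E H) (y : H) (μ : ℝ) : ℝ :=
  dualNorm (hess P.f y) (grad P.f y - μ⁻¹ • P.b)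

/-- The neighborhood `N(μ, β)` of the central path (contained in the domain `int Q` of `f`). -/
def nbhd (P : Problem E H) (μ β : ℝ) : Set H := {y | y ∈ interior P.Q ∧ P.proximity y μ ≤ β}

/-- The predicted point `p(y) = y + [∇²f(y)]⁻¹ ∇f(y)`. -/
def pred (P : Problem E H) (y : H) : H := y + (hess P.f y).inverse (grad P.f y)

end Problem

end ConicIPM

end

noncomputable section

namespace ConicIPM

/-! ### Quadratic forms -/

section QuadraticForms

variable {V : Type*} [NormedAddCommGroup V] [NormedSpace ℝ V]

/-! Let `x` be the point of `int K` with `∇F(x) = -s(y)`. Then `∇f(y) = A x` and `∇²f(y) = A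
[∇²F(x)]⁻¹ A^*`, while logarithmic homogeneity gives `[∇²F(x)]⁻¹ s(y) = x`. Since `s_* = s(y) +
A^*(y - y_*)`, the prediction error `w = p(y) - y_*` satisfies the exact identity `∇²f(y) w = A v`
with `v = [∇²F(x)]⁻¹ s_*` (`hess_f_pred_sub`). Pairing with `w` gives `‖w‖_y² ≤ ‖w‖_G ‖v‖_B`.

Sharpness turns the local norm into the `G`-norm: the Dikin ellipsoid at `y` lies in `Q`, and
sharpness at its opposite points `y ± h` yields `γ_d ‖h‖_G ≤ ⟨b, y_* - y⟩ ‖h‖_y`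
(`primalNorm_G_le`). Together, `‖w‖_G ≤ ⟨b, y - y_*⟩² ‖v‖_B / γ_d²`.

It remains to bound `‖v‖_B` (`primalNorm_B_inverse_hess_le`). The reference point is `x' = x_μ / μ`,
for which `∇F(x') = -s_μ`, so that `[∇²F(x')]⁻¹ s_*` is the vector bounded by `σ_d`. The proximity
condition forces `x` and `x'` to be close in the local metric, hence their Hessians agree up to the
factor `(1 - 2β)⁻³` and the inverses differ by a relative error `12β`. Since the dual local norm of
`s_*` at `x'` is at most `ν`, and the norm of `B` is at most `2ν/μ` times the local norm at `x'`,
the change of `v` costs `24ν²β/μ`.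

The second inequality is Cauchy–Schwarz for `b = A x_1`, because `‖x_1‖_B² = ν`. -/

/-- Symmetric positive semidefinite operators from a space to its dual. -/
structure IsPSD (M : V →L[ℝ] StrongDual ℝ V) : Prop where
  symm : ∀ u v, M u v = M v u
  nonneg : ∀ u, 0 ≤ M u u

/-- Symmetric positive definite operators from a space to its dual. -/
structure IsPD (M : V →L[ℝ] StrongDual ℝ V) : Prop extends IsPSD M where
  eq_zero : ∀ u, M u u = 0 → u = 0

theorem primalNorm_nonneg (M : V →L[ℝ] StrongDual ℝ V) (u : V) : 0 ≤ primalNorm M u :=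
  Real.sqrt_nonneg _

theorem dualNorm_nonneg (M : V →L[ℝ] StrongDual ℝ V) (s : StrongDual ℝ V) :
    0 ≤ dualNorm M s := Real.sqrt_nonneg _

variable {M N : V →L[ℝ] StrongDual ℝ V}

theorem IsPSD.sq_primalNorm (hM : IsPSD M) (u : V) : primalNorm M u ^ 2 = M u u :=
  Real.sq_sqrt (hM.nonneg u)

theorem primalNorm_smul (M : V →L[ℝ] StrongDual ℝ V) (a : ℝ) (u : V) :
    primalNorm M (a • u) = |a| * primalNorm M u := by
  unfold primalNorm
  rw [← Real.sqrt_sq_eq_abs, ← Real.sqrt_mul (sq_nonneg a)]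
  congr 1
  simp only [map_smul, smul_apply, smul_eq_mul]
  ring

theorem primalNorm_sub_comm (M : V →L[ℝ] StrongDual ℝ V) (u v : V) :
    primalNorm M (u - v) = primalNorm M (v - u) := by
  have := primalNorm_smul M (-1) (u - v)
  simpa using this.symm

theorem IsPSD.sq_apply_le (hM : IsPSD M) (u v : V) : M u v ^ 2 ≤ M u u * M v v := by
  have h : ∀ t : ℝ, 0 ≤ M v v * (t * t) + (2 * M u v) * t + M u u := fun t => by
    have := hM.nonneg (u + t • v)
    simp only [map_add, map_smul, add_apply, smul_apply,
      smul_eq_mul, hM.symm v u] at this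
    linarith
  have := discrim_le_zero h
  unfold discrim at this
  linarith

theorem IsPSD.abs_apply_le (hM : IsPSD M) (u v : V) :
    |M u v| ≤ primalNorm M u * primalNorm M v := by
  apply abs_le_of_sq_le_sq _ (mul_nonneg (primalNorm_nonneg _ _) (primalNorm_nonneg _ _))
  rw [mul_pow, hM.sq_primalNorm, hM.sq_primalNorm]
  exact hM.sq_apply_le u v

theorem IsPSD.apply_le (hM : IsPSD M) (u v : V) : M u v ≤ primalNorm M u * primalNorm M v :=
  (le_abs_self _).trans (hM.abs_apply_le u v)

theorem IsPSD.primalNorm_add_le (hM : IsPSD M) (u v : V) :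
    primalNorm M (u + v) ≤ primalNorm M u + primalNorm M v := by
  apply le_of_sq_le_sq _ (add_nonneg (primalNorm_nonneg _ _) (primalNorm_nonneg _ _))
  rw [hM.sq_primalNorm]
  have h1 := hM.apply_le u v
  have h2 := hM.sq_primalNorm u
  have h3 := hM.sq_primalNorm v
  simp only [map_add, add_apply, hM.symm v u]
  nlinarith

/-- A linear function bounded by `C` on the open unit ellipsoid is bounded by `C ‖·‖_M`. -/
theorem IsPSD.le_mul_primalNorm (hM : IsPSD M) (g : V →L[ℝ] ℝ) {C : ℝ}
    (hg : ∀ h, M h h < 1 → g h ≤ C) (h : V) : g h ≤ C * primalNorm M h := by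
  have hC : 0 ≤ C := by simpa using hg 0 (by simp)
  -- The form may be degenerate, so `h` is scaled by some `t` strictly above its norm, and `t` is
  -- then sent to the norm.
  have key : ∀ t, primalNorm M h < t → g h ≤ C * t := fun t ht => by
    have ht0 : 0 < t := (primalNorm_nonneg _ _).trans_lt ht
    have h1 : M (t⁻¹ • h) (t⁻¹ • h) < 1 := by
      rw [← hM.sq_primalNorm, primalNorm_smul, abs_of_pos (inv_pos.2 ht0)]
      have h3 := primalNorm_nonneg M h
      have : t⁻¹ * primalNorm M h < 1 := by
        rw [inv_mul_lt_iff₀ ht0]; linarith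
      have h4 : 0 ≤ t⁻¹ * primalNorm M h := by positivity
      nlinarith
    have h2 := hg _ h1
    rw [map_smul, smul_eq_mul, inv_mul_le_iff₀ ht0] at h2
    linarith
  refine ge_of_tendsto (x := 𝓝[>] (primalNorm M h)) (f := fun t => C * t)
    (((continuous_const.mul continuous_id).tendsto _).mono_left nhdsWithin_le_nhds) ?_
  filter_upwards [self_mem_nhdsWithin] with t ht using key t ht

/-- A symmetric form whose quadratic form is dominated by `κ M` satisfies a Cauchy–Schwarz
inequality relative to `M`. -/
theorem IsPSD.abs_apply_le_of_abs_le (hM : IsPSD M) {D : V →L[ℝ] StrongDual ℝ V}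
    (hD : ∀ u v, D u v = D v u) {κ : ℝ} (hκ : 0 ≤ κ) (hDM : ∀ u, |D u u| ≤ κ * M u u) (u v : V) :
    |D u v| ≤ κ * (primalNorm M u * primalNorm M v) := by
  -- Both `P = κM + D` and `N = κM - D` are positive semidefinite, with `P - N = 2D` and `P + N =
  -- 2κM`; adding their Cauchy–Schwarz inequalities bounds `(P - N)(u, v)²` by the product of the
  -- values of `P + N`.
  have hP : IsPSD (κ • M + D) := ⟨fun a b => by simp [hM.symm a b, hD a b], fun a => by
    have := (abs_le.1 (hDM a)).1
    simp only [add_apply, smul_apply, smul_eq_mul]; linarith⟩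
  have hN : IsPSD (κ • M - D) := ⟨fun a b => by simp [hM.symm a b, hD a b], fun a => by
    have := (abs_le.1 (hDM a)).2
    simp only [sub_apply, smul_apply, smul_eq_mul]; linarith⟩
  have eP := hP.sq_apply_le u v
  have eN := hN.sq_apply_le u v
  have Pu := hP.nonneg u
  have Pv := hP.nonneg v
  have Nu := hN.nonneg u
  have Nv := hN.nonneg v
  set P := (κ • M + D) with hPd
  set N := (κ • M - D) with hNd
  have h1 : P u v - N u v = 2 * D u v := by simp [hPd, hNd]; ring
  have h2 : P u u + N u u = 2 * (κ * M u u) := by simp [hPd, hNd]; ring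
  have h3 : P v v + N v v = 2 * (κ * M v v) := by simp [hPd, hNd]; ring
  have h4 : |2 * (P u v * N u v)| ≤ P u u * N v v + N u u * P v v := by
    apply abs_le_of_sq_le_sq _ (by positivity)
    have : (P u v) ^ 2 * (N u v) ^ 2 ≤ (P u u * P v v) * (N u u * N v v) :=
      mul_le_mul eP eN (sq_nonneg _) (by positivity)
    nlinarith [sq_nonneg (P u u * N v v - N u u * P v v)]
  have h5 : (P u v - N u v) ^ 2 ≤ (P u u + N u u) * (P v v + N v v) := by
    have := (abs_le.1 h4).1
    nlinarith
  rw [h1, h2, h3] at h5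
  apply abs_le_of_sq_le_sq _
    (mul_nonneg hκ (mul_nonneg (primalNorm_nonneg _ _) (primalNorm_nonneg _ _)))
  rw [mul_pow, mul_pow, hM.sq_primalNorm, hM.sq_primalNorm]
  linarith

/-! ### Inverses and dual norms of positive definite forms. -/

section Inverse

variable [FiniteDimensional ℝ V]

theorem finrank_strongDual (W : Type*) [NormedAddCommGroup W] [NormedSpace ℝ W]
    [FiniteDimensional ℝ W] : Module.finrank ℝ (StrongDual ℝ W) = Module.finrank ℝ W := by
  rw [← (LinearMap.toContinuousLinearMap (𝕜 := ℝ) (E := W) (F' := ℝ)).finrank_eq]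
  exact Subspace.dual_finrank_eq

theorem IsPD.isInvertible (hM : IsPD M) : M.IsInvertible := by
  have hinj : Function.Injective (M : V →ₗ[ℝ] StrongDual ℝ V) := by
    rw [← LinearMap.ker_eq_bot, LinearMap.ker_eq_bot']
    intro u hu
    apply hM.eq_zero
    have : M u = 0 := hu
    simp [this]
  exact ⟨(LinearEquiv.ofInjectiveOfFinrankEq (M : V →ₗ[ℝ] StrongDual ℝ V) hinj
    (finrank_strongDual V).symm).toContinuousLinearEquiv, by ext; rfl⟩

theorem IsPD.apply_inverse (hM : IsPD M) (s : StrongDual ℝ V) : M (M.inverse s) = s :=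
  hM.isInvertible.self_apply_inverse s

theorem IsPD.inverse_apply (hM : IsPD M) (u : V) : M.inverse (M u) = u :=
  hM.isInvertible.inverse_apply_self u

theorem IsPD.dualNorm_eq (hM : IsPD M) (s : StrongDual ℝ V) :
    dualNorm M s = primalNorm M (M.inverse s) := by
  unfold dualNorm primalNorm
  rw [hM.apply_inverse]

theorem IsPD.apply_le_dualNorm (hM : IsPD M) (s : StrongDual ℝ V) (u : V) :
    s u ≤ dualNorm M s * primalNorm M u := by
  rw [hM.dualNorm_eq]
  conv_lhs => rw [← hM.apply_inverse s]
  exact hM.apply_le _ _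

theorem IsPD.sq_dualNorm (hM : IsPD M) (s : StrongDual ℝ V) :
    dualNorm M s ^ 2 = s (M.inverse s) := by
  rw [hM.dualNorm_eq, hM.sq_primalNorm, hM.apply_inverse]

theorem IsPD.dualNorm_le (hM : IsPD M) {s : StrongDual ℝ V} {C : ℝ} (hC : 0 ≤ C)
    (h : ∀ u, s u ≤ C * primalNorm M u) : dualNorm M s ≤ C := by
  have h1 := h (M.inverse s)
  rw [← hM.dualNorm_eq, ← hM.sq_dualNorm] at h1
  have := dualNorm_nonneg M s
  by_contra hcon
  nlinarith

theorem IsPD.inverse_symm (hM : IsPD M) (s t : StrongDual ℝ V) :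
    s (M.inverse t) = t (M.inverse s) := by
  conv_lhs => rw [← hM.apply_inverse s]
  rw [hM.symm, hM.apply_inverse]

/-- Inversion is antitone. -/
theorem IsPD.inverse_le (hM : IsPD M) (hN : IsPD N) {θ : ℝ} (hθ : 0 ≤ θ)
    (h : ∀ u, M u u ≤ θ * N u u) (s : StrongDual ℝ V) :
    s (N.inverse s) ≤ θ * s (M.inverse s) := by
  -- Cauchy–Schwarz in `M` gives `⟨s, N⁻¹s⟩² ≤ ⟨s, M⁻¹s⟩ · θ⟨s, N⁻¹s⟩`; one factor then cancels.
  have h1 := hM.sq_apply_le (M.inverse s) (N.inverse s)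
  have h2 := h (N.inverse s)
  rw [hM.apply_inverse] at h1
  rw [hN.apply_inverse] at h2
  have h3 : 0 ≤ s (M.inverse s) := by rw [← hM.sq_dualNorm]; positivity
  have h4 : 0 ≤ s (N.inverse s) := by rw [← hN.sq_dualNorm]; positivity
  rcases h4.eq_or_lt with h0 | h0
  · rw [← h0]; positivity
  · have h5 := mul_le_mul_of_nonneg_left h2 h3
    by_contra hcon
    nlinarith

/-- If two positive definite forms are within a factor `θ` of each other, then their inverses
differ by at most `θ - 1` relative to the second one. -/
theorem IsPD.primalNorm_inverse_sub_le (hM : IsPD M) (hN : IsPD N) {θ : ℝ} (hθ : 1 ≤ θ)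
    (h1 : ∀ u, M u u ≤ θ * N u u) (h2 : ∀ u, N u u ≤ θ * M u u) (s : StrongDual ℝ V) :
    primalNorm N (M.inverse s - N.inverse s) ≤ (θ - 1) * dualNorm N s := by
  -- The difference of inverses is treated as a form on the dual space, dominated by `(θ - 1) N⁻¹`.
  -- Testing it against `N v` recovers `‖v‖_N²`.
  set D : StrongDual ℝ V →L[ℝ] StrongDual ℝ (StrongDual ℝ V) :=
    (NormedSpace.inclusionInDoubleDual ℝ V).comp (M.inverse - N.inverse) with hD
  set I : StrongDual ℝ V →L[ℝ] StrongDual ℝ (StrongDual ℝ V) :=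
    (NormedSpace.inclusionInDoubleDual ℝ V).comp N.inverse with hI
  have hDa : ∀ s t, D s t = t (M.inverse s) - t (N.inverse s) := fun s t =>
    map_sub t (M.inverse s) (N.inverse s)
  have hIa : ∀ s t, I s t = t (N.inverse s) := fun s t => by simp [hI]
  have hIP : IsPSD I := ⟨fun s t => by rw [hIa, hIa, hN.inverse_symm], fun s => by
    rw [hIa, ← hN.sq_dualNorm]; positivity⟩
  have hIn : ∀ t, primalNorm I t = dualNorm N t := fun t => by
    unfold primalNorm dualNorm; rw [hIa]
  set v := M.inverse s - N.inverse s with hv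
  have key := hIP.abs_apply_le_of_abs_le (D := D)
    (fun s t => by rw [hDa, hDa, hM.inverse_symm, hN.inverse_symm]) (sub_nonneg.2 hθ)
    (fun t => by
      rw [hDa, hIa]
      have a1 := hM.inverse_le hN (by linarith) h1 t
      have a2 := hN.inverse_le hM (by linarith) h2 t
      have a3 : 0 ≤ t (N.inverse t) := by rw [← hN.sq_dualNorm]; positivity
      rw [abs_le]
      constructor
      -- The lower bound uses `1/θ ≥ 2 - θ`, that is, `(θ - 1)² ≥ 0`.
      · by_contra hcon
        have : t (M.inverse t) < (2 - θ) * t (N.inverse t) := by linarith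
        nlinarith [mul_nonneg (sq_nonneg (θ - 1)) a3]
      · linarith) s (N v)
  rw [hDa, ← map_sub, hIn, hIn, hN.dualNorm_eq (N v), hN.inverse_apply, ← hv,
    ← hN.sq_primalNorm] at key
  have h3 := le_of_abs_le key
  have h4 := primalNorm_nonneg N v
  have h5 : 0 ≤ (θ - 1) * dualNorm N s := mul_nonneg (sub_nonneg.2 hθ) (dualNorm_nonneg N s)
  by_contra hcon
  nlinarith

end Inverse

/-- The bound `|T(h, u, u)| ≤ 3 ‖h‖ ‖u‖²` for a symmetric trilinear form with
`|T(h, h, h)| ≤ 2 ‖h‖³`. -/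
theorem IsPSD.abs_trilinear_le (hM : IsPSD M) (T : V →L[ℝ] V →L[ℝ] StrongDual ℝ V)
    (hT1 : ∀ a b c, T a b c = T b a c) (hT2 : ∀ a b c, T a b c = T a c b)
    (hT : ∀ h, |T h h h| ≤ 2 * primalNorm M h ^ 3) (h u : V) :
    |T h u u| ≤ 3 * primalNorm M h * M u u := by
  have unit : ∀ a b, primalNorm M a ≤ 1 → primalNorm M b ≤ 1 → |T a b b| ≤ 3 := by
    intro a b ha hb
    -- Polarization with step 2: the cubic bound and the parallelogram law give `24 |T(a, b, b)| ≤ 6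
    -- · (2 + 8) + 4 = 64`. The resulting `8/3` is rounded up to 3; the sharp constant 2 is not
    -- needed.
    have e : T (a + (2 : ℝ) • b) (a + (2 : ℝ) • b) (a + (2 : ℝ) • b) +
        T (a - (2 : ℝ) • b) (a - (2 : ℝ) • b) (a - (2 : ℝ) • b) = 2 * T a a a + 24 * T a b b := by
      simp only [map_add, map_sub, map_smul, add_apply, sub_apply, smul_apply, smul_eq_mul]
      rw [hT1 b a b, hT2 b b a, hT1 b a b]
      ring
    have b1 := hT (a + (2 : ℝ) • b)
    have b2 := hT (a - (2 : ℝ) • b)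
    have b3 := hT a
    have n2 : primalNorm M ((2 : ℝ) • b) ≤ 2 := by
      rw [primalNorm_smul, abs_of_pos two_pos]; linarith
    have n3 : primalNorm M (-((2 : ℝ) • b)) ≤ 2 := by
      rw [← neg_one_smul ℝ, primalNorm_smul]; simpa using n2
    have p1 : primalNorm M (a + (2 : ℝ) • b) ≤ 3 := (hM.primalNorm_add_le _ _).trans (by linarith)
    have p2 : primalNorm M (a - (2 : ℝ) • b) ≤ 3 := by
      rw [sub_eq_add_neg]
      exact (hM.primalNorm_add_le _ _).trans (by linarith)
    have pa := primalNorm_nonneg M a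
    have pb := primalNorm_nonneg M b
    have q1 := primalNorm_nonneg M (a + (2 : ℝ) • b)
    have q2 := primalNorm_nonneg M (a - (2 : ℝ) • b)
    have para : primalNorm M (a + (2 : ℝ) • b) ^ 2 + primalNorm M (a - (2 : ℝ) • b) ^ 2 =
        2 * primalNorm M a ^ 2 + 8 * primalNorm M b ^ 2 := by
      simp only [hM.sq_primalNorm, map_add, map_sub, map_smul, add_apply, sub_apply, smul_apply,
        smul_eq_mul]
      ring
    have c1 : primalNorm M (a + (2 : ℝ) • b) ^ 3 ≤ 3 * primalNorm M (a + (2 : ℝ) • b) ^ 2 := by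
      rw [pow_succ']; exact mul_le_mul_of_nonneg_right p1 (sq_nonneg _)
    have c2 : primalNorm M (a - (2 : ℝ) • b) ^ 3 ≤ 3 * primalNorm M (a - (2 : ℝ) • b) ^ 2 := by
      rw [pow_succ']; exact mul_le_mul_of_nonneg_right p2 (sq_nonneg _)
    have c3 : primalNorm M a ^ 3 ≤ 1 := pow_le_one₀ pa ha
    have c4 : primalNorm M a ^ 2 ≤ 1 := pow_le_one₀ pa ha
    have c5 : primalNorm M b ^ 2 ≤ 1 := pow_le_one₀ pb hb
    rw [abs_le] at b1 b2 b3 ⊢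
    constructor <;> linarith
  have key : ∀ ε : ℝ, 0 < ε → |T h u u| ≤ 3 * (primalNorm M h + ε) * (primalNorm M u + ε) ^ 2 := by
    intro ε hε
    have ph := primalNorm_nonneg M h
    have pu := primalNorm_nonneg M u
    set α := primalNorm M h + ε
    set ω := primalNorm M u + ε
    have hα : 0 < α := by positivity
    have hω : 0 < ω := by positivity
    have e := unit (α⁻¹ • h) (ω⁻¹ • u)
      (by rw [primalNorm_smul, abs_of_pos (inv_pos.2 hα), inv_mul_le_iff₀ hα]; simp [α, hε.le])
      (by rw [primalNorm_smul, abs_of_pos (inv_pos.2 hω), inv_mul_le_iff₀ hω]; simp [ω, hε.le])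
    simp only [map_smul, smul_apply, smul_eq_mul] at e
    rw [show ω⁻¹ * (ω⁻¹ * (α⁻¹ * T h u u)) = T h u u / (α * ω ^ 2) by field_simp, abs_div,
      abs_of_pos (show 0 < α * ω ^ 2 by positivity), div_le_iff₀ (by positivity)] at e
    linarith
  rw [← hM.sq_primalNorm u]
  have lim : Tendsto (fun ε : ℝ => 3 * (primalNorm M h + ε) * (primalNorm M u + ε) ^ 2) (𝓝[>] 0)
      (𝓝 (3 * (primalNorm M h + 0) * (primalNorm M u + 0) ^ 2)) :=
    ((by fun_prop : Continuous fun ε : ℝ =>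
      3 * (primalNorm M h + ε) * (primalNorm M u + ε) ^ 2).tendsto 0).mono_left nhdsWithin_le_nhds
  simp only [add_zero] at lim
  refine ge_of_tendsto lim ?_
  filter_upwards [self_mem_nhdsWithin] with ε hε using key ε hε

end QuadraticForms

/-! ### A differential inequality -/

section Line

variable {φ φ' : ℝ → ℝ} {T : ℝ}

/-- The hypothesis says that `φ^{-1/2}` is 1-Lipschitz. The shift by `ε` keeps this meaningful where
`φ` vanishes. -/
theorem abs_inv_sqrt_sub_le (hd : ∀ t ∈ Icc 0 T, HasDerivAt φ (φ' t) t)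
    (h0 : ∀ t ∈ Icc 0 T, 0 ≤ φ t) (hb : ∀ t ∈ Icc 0 T, |φ' t| ≤ 2 * √(φ t) ^ 3)
    {ε : ℝ} (hε : 0 < ε) {t : ℝ} (ht : t ∈ Icc 0 T) :
    |(√(φ t + ε))⁻¹ - (√(φ 0 + ε))⁻¹| ≤ t := by
  have hder : ∀ τ ∈ Icc 0 T, HasDerivAt (fun τ => (√(φ τ + ε))⁻¹)
      (-(φ' τ / (2 * √(φ τ + ε))) / √(φ τ + ε) ^ 2) τ := fun τ hτ => by
    have hp : 0 < φ τ + ε := by linarith [h0 τ hτ]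
    exact (((hd τ hτ).add_const ε).sqrt hp.ne').inv (Real.sqrt_pos.2 hp).ne'
  have hbd : ∀ τ ∈ Icc 0 T, ‖-(φ' τ / (2 * √(φ τ + ε))) / √(φ τ + ε) ^ 2‖ ≤ 1 := fun τ hτ => by
    have hp : 0 < √(φ τ + ε) := Real.sqrt_pos.2 (by linarith [h0 τ hτ])
    have hle : √(φ τ) ^ 3 ≤ √(φ τ + ε) ^ 3 :=
      pow_le_pow_left₀ (Real.sqrt_nonneg _) (Real.sqrt_le_sqrt (by linarith)) 3
    rw [Real.norm_eq_abs, abs_div, abs_neg, abs_div, abs_of_pos (by positivity : 0 < 2 * √(φ τ + ε)),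
      abs_of_pos (by positivity : 0 < √(φ τ + ε) ^ 2), div_div, div_le_one (by positivity)]
    have := hb τ hτ
    nlinarith
  have := (convex_Icc 0 T).norm_image_sub_le_of_norm_hasDerivWithin_le
    (fun τ hτ => (hder τ hτ).hasDerivWithinAt) hbd (left_mem_Icc.2 (ht.1.trans ht.2)) ht
  simpa [abs_of_nonneg ht.1] using this

/-- Clearing the inverse square roots gives inequalities that survive the limit `ε → 0`, even at
zeros of `φ`. -/
theorem sqrt_mul_le_and_le_sqrt_mul (hd : ∀ t ∈ Icc 0 T, HasDerivAt φ (φ' t) t)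
    (h0 : ∀ t ∈ Icc 0 T, 0 ≤ φ t) (hb : ∀ t ∈ Icc 0 T, |φ' t| ≤ 2 * √(φ t) ^ 3)
    {t : ℝ} (ht : t ∈ Icc 0 T) :
    √(φ t) * (1 - t * √(φ 0)) ≤ √(φ 0) ∧ √(φ 0) ≤ √(φ t) * (1 + t * √(φ 0)) := by
  have key : ∀ ε > 0, √(φ t + ε) * (1 - t * √(φ 0 + ε)) ≤ √(φ 0 + ε) ∧
      √(φ 0 + ε) ≤ √(φ t + ε) * (1 + t * √(φ 0 + ε)) := fun ε hε => by
    have h := abs_le.1 (abs_inv_sqrt_sub_le hd h0 hb hε ht)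
    have hp : 0 < √(φ t + ε) := Real.sqrt_pos.2 (by linarith [h0 t ht])
    have hq : 0 < √(φ 0 + ε) :=
      Real.sqrt_pos.2 (by linarith [h0 0 (left_mem_Icc.2 (ht.1.trans ht.2))])
    set p := √(φ t + ε)
    set q := √(φ 0 + ε)
    have e1 : p * q * (p⁻¹ - q⁻¹) = q - p := by field_simp
    have hpq : 0 < p * q := mul_pos hp hq
    have l1 := mul_le_mul_of_nonneg_left h.1 hpq.le
    have l2 := mul_le_mul_of_nonneg_left h.2 hpq.le
    rw [e1] at l1 l2
    constructor <;> nlinarith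
  have lim : ∀ f : ℝ → ℝ, Continuous f → Tendsto f (𝓝[>] 0) (𝓝 (f 0)) := fun f hf =>
    (hf.tendsto 0).mono_left nhdsWithin_le_nhds
  constructor
  · have := le_of_tendsto_of_tendsto
      (lim (fun ε => √(φ t + ε) * (1 - t * √(φ 0 + ε))) (by fun_prop))
      (lim (fun ε => √(φ 0 + ε)) (by fun_prop))
      (by filter_upwards [self_mem_nhdsWithin] with ε hε using (key ε hε).1)
    simpa using this
  · have := le_of_tendsto_of_tendsto
      (lim (fun ε => √(φ 0 + ε)) (by fun_prop))
      (lim (fun ε => √(φ t + ε) * (1 + t * √(φ 0 + ε))) (by fun_prop))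
      (by filter_upwards [self_mem_nhdsWithin] with ε hε using (key ε hε).2)
    simpa using this

theorem le_of_hasDerivAt_le {f g f' g' : ℝ → ℝ} (hf : ∀ t ∈ Icc 0 T, HasDerivAt f (f' t) t)
    (hg : ∀ t ∈ Icc 0 T, HasDerivAt g (g' t) t) (h0 : f 0 ≤ g 0)
    (hle : ∀ t ∈ Icc 0 T, f' t ≤ g' t) {t : ℝ} (ht : t ∈ Icc 0 T) : f t ≤ g t := by
  have hmono : MonotoneOn (fun t => g t - f t) (Icc 0 T) :=
    monotoneOn_of_hasDerivWithinAt_nonneg (convex_Icc 0 T)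
      (fun τ hτ => ((hg τ hτ).sub (hf τ hτ)).continuousAt.continuousWithinAt)
      (fun τ hτ => ((hg τ (interior_subset hτ)).sub (hf τ (interior_subset hτ))).hasDerivWithinAt)
      (fun τ hτ => sub_nonneg.2 (hle τ (interior_subset hτ)))
  have := hmono (left_mem_Icc.2 (ht.1.trans ht.2)) ht ht.1
  simp only at this
  linarith

end Line

/-! ### Self-concordant functions -/

namespace IsSelfConcordant

variable {V : Type*} [NormedAddCommGroup V] [NormedSpace ℝ V] {Q : Set V} {Φ : V → ℝ}

theorem contDiffAt (hΦ : IsSelfConcordant Q Φ) {x : V} (hx : x ∈ interior Q) :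
    ContDiffAt ℝ 3 Φ x :=
  hΦ.contDiffOn.contDiffAt (isOpen_interior.mem_nhds hx)

theorem contDiffAt_grad (hΦ : IsSelfConcordant Q Φ) {x : V} (hx : x ∈ interior Q) :
    ContDiffAt ℝ 2 (grad Φ) x :=
  (hΦ.contDiffAt hx).fderiv_right (by norm_num)

theorem contDiffAt_hess (hΦ : IsSelfConcordant Q Φ) {x : V} (hx : x ∈ interior Q) :
    ContDiffAt ℝ 1 (hess Φ) x :=
  (hΦ.contDiffAt_grad hx).fderiv_right (by norm_num)

theorem hasFDerivAt (hΦ : IsSelfConcordant Q Φ) {x : V} (hx : x ∈ interior Q) :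
    HasFDerivAt Φ (grad Φ x) x :=
  ((hΦ.contDiffAt hx).differentiableAt (by norm_num)).hasFDerivAt

theorem hasFDerivAt_grad (hΦ : IsSelfConcordant Q Φ) {x : V} (hx : x ∈ interior Q) :
    HasFDerivAt (grad Φ) (hess Φ x) x :=
  ((hΦ.contDiffAt_grad hx).differentiableAt (by norm_num)).hasFDerivAt

theorem hasFDerivAt_hess (hΦ : IsSelfConcordant Q Φ) {x : V} (hx : x ∈ interior Q) :
    HasFDerivAt (hess Φ) (fderiv ℝ (hess Φ) x) x :=
  ((hΦ.contDiffAt_hess hx).differentiableAt (by norm_num)).hasFDerivAt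

theorem hess_symm (hΦ : IsSelfConcordant Q Φ) {x : V} (hx : x ∈ interior Q) (u v : V) :
    hess Φ x u v = hess Φ x v u :=
  ((hΦ.contDiffAt hx).isSymmSndFDerivAt (by simp; norm_num)).eq u v

theorem third_symm_left (hΦ : IsSelfConcordant Q Φ) {x : V} (hx : x ∈ interior Q) (u v w : V) :
    fderiv ℝ (hess Φ) x u v w = fderiv ℝ (hess Φ) x v u w := by
  have : fderiv ℝ (hess Φ) x u v = fderiv ℝ (hess Φ) x v u :=
    ((hΦ.contDiffAt_grad hx).isSymmSndFDerivAt (by simp)).eq u v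
  rw [this]

theorem hasDerivAt_line (_ : IsSelfConcordant Q Φ) {W : Type*} [NormedAddCommGroup W]
    [NormedSpace ℝ W] {f : V → W} {f' : V →L[ℝ] W} {x h : V} {t : ℝ}
    (hf : HasFDerivAt f f' (x + t • h)) : HasDerivAt (fun τ : ℝ => f (x + τ • h)) (f' h) t := by
  have h1 : HasDerivAt (fun τ : ℝ => x + τ • h) h t := by
    simpa using ((hasDerivAt_id t).smul_const h).const_add x
  exact hf.comp_hasDerivAt t h1

theorem hasDerivAt_hess_apply (hΦ : IsSelfConcordant Q Φ) {x h : V} {t : ℝ}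
    (hx : x + t • h ∈ interior Q) (u v : V) :
    HasDerivAt (fun τ : ℝ => hess Φ (x + τ • h) u v)
      (fderiv ℝ (hess Φ) (x + t • h) h u v) t := by
  have := hΦ.hasDerivAt_line (f := hess Φ) (x := x) (h := h) (t := t) (hΦ.hasFDerivAt_hess hx)
  have h2 := (this.clm_apply (hasDerivAt_const t u)).clm_apply (hasDerivAt_const t v)
  simpa using h2

theorem hasDerivAt_grad_apply (hΦ : IsSelfConcordant Q Φ) {x h : V} {t : ℝ}
    (hx : x + t • h ∈ interior Q) (u : V) :
    HasDerivAt (fun τ : ℝ => grad Φ (x + τ • h) u) (hess Φ (x + t • h) h u) t := by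
  simpa using (hΦ.hasDerivAt_line (hΦ.hasFDerivAt_grad hx)).clm_apply (hasDerivAt_const t u)

/-- The symmetry of the Hessian holds near `x`, so it can be differentiated along `u`. -/
theorem third_symm_right (hΦ : IsSelfConcordant Q Φ) {x : V} (hx : x ∈ interior Q) (u v w : V) :
    fderiv ℝ (hess Φ) x u v w = fderiv ℝ (hess Φ) x u w v := by
  have h1 := hΦ.hasDerivAt_hess_apply (x := x) (h := u) (t := 0) (by simpa using hx) v w
  have h2 := hΦ.hasDerivAt_hess_apply (x := x) (h := u) (t := 0) (by simpa using hx) w v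
  have hU : ∀ᶠ τ : ℝ in 𝓝 0, x + τ • u ∈ interior Q := by
    have : ContinuousAt (fun τ : ℝ => x + τ • u) 0 := by fun_prop
    exact this.eventually_mem (isOpen_interior.mem_nhds (by simpa using hx))
  have h3 := h2.congr_of_eventuallyEq (f₁ := fun τ : ℝ => hess Φ (x + τ • u) v w)
    (by filter_upwards [hU] with τ hτ using hΦ.hess_symm hτ v w)
  simpa using h1.unique h3

/-- The gradient inequality. -/
theorem grad_sub_le (hΦ : IsSelfConcordant Q Φ) {x z : V} (hx : x ∈ interior Q)
    (hz : z ∈ interior Q) : Φ x + grad Φ x (z - x) ≤ Φ z := by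
  have hd := hΦ.hasDerivAt_line (x := x) (h := z - x) (t := 0)
    (hΦ.hasFDerivAt (by simpa using hx))
  rw [zero_smul, add_zero] at hd
  have hs := (hasDerivAt_iff_tendsto_slope.1 hd).mono_left
    (nhdsWithin_mono (0 : ℝ) (s := Ioi 0) fun t ht => ne_of_gt ht)
  have := le_of_tendsto hs (b := Φ z - Φ x) (by
    filter_upwards [Ioo_mem_nhdsGT (zero_lt_one' ℝ)] with t ht
    have hc := hΦ.convexOn.2 hx hz (sub_nonneg.2 ht.2.le) ht.1.le (by ring)
    have e : (1 - t) • x + t • z = x + t • (z - x) := by module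
    rw [e] at hc
    simp only [smul_eq_mul] at hc
    rw [slope_def_field, div_le_iff₀ (by linarith [ht.1])]
    simp only [zero_smul, add_zero, sub_zero]
    linarith)
  linarith

/-- Adding the gradient inequalities in both directions shows that the gradient is monotone; its
difference quotients along `h` are therefore nonnegative. -/
theorem isPSD_hess (hΦ : IsSelfConcordant Q Φ) {x : V} (hx : x ∈ interior Q) :
    IsPSD (hess Φ x) := by
  refine ⟨hΦ.hess_symm hx, fun h => ?_⟩
  have hd := hΦ.hasDerivAt_grad_apply (x := x) (h := h) (t := 0) (by simpa using hx) h
  rw [zero_smul, add_zero] at hd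
  have hs := (hasDerivAt_iff_tendsto_slope.1 hd).mono_left
    (nhdsWithin_mono (0 : ℝ) (s := Ioi 0) fun t ht => ne_of_gt ht)
  have hU : ∀ᶠ τ : ℝ in 𝓝[>] 0, x + τ • h ∈ interior Q := by
    have : ContinuousAt (fun τ : ℝ => x + τ • h) 0 := by fun_prop
    exact nhdsWithin_le_nhds
      (this.eventually_mem (isOpen_interior.mem_nhds (by simpa using hx)))
  refine ge_of_tendsto hs ?_
  filter_upwards [hU, self_mem_nhdsWithin] with t ht ht0
  have ht0 : 0 < t := ht0
  have h1 := hΦ.grad_sub_le hx ht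
  have h2 := hΦ.grad_sub_le ht hx
  simp only [add_sub_cancel_left, sub_add_cancel_left, map_neg, map_smul, smul_eq_mul] at h1 h2
  rw [slope_def_field]
  simp only [zero_smul, add_zero, sub_zero]
  apply div_nonneg _ ht0.le
  by_contra hcon
  nlinarith

theorem abs_third_le (hΦ : IsSelfConcordant Q Φ) {x : V} (hx : x ∈ interior Q) (h : V) :
    |fderiv ℝ (hess Φ) x h h h| ≤ 2 * primalNorm (hess Φ x) h ^ 3 := by
  have := hΦ.third_le x hx h
  have e : (hess Φ x h h) ^ (3 / 2 : ℝ) = primalNorm (hess Φ x) h ^ 3 := by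
    unfold primalNorm
    rw [Real.sqrt_eq_rpow, ← Real.rpow_natCast, ← Real.rpow_mul ((hΦ.isPSD_hess hx).nonneg h)]
    norm_num
  rwa [e] at this

theorem abs_third_apply_le (hΦ : IsSelfConcordant Q Φ) {x : V} (hx : x ∈ interior Q) (h u : V) :
    |fderiv ℝ (hess Φ) x h u u| ≤ 3 * primalNorm (hess Φ x) h * hess Φ x u u :=
  (hΦ.isPSD_hess hx).abs_trilinear_le _ (hΦ.third_symm_left hx) (hΦ.third_symm_right hx)
    (hΦ.abs_third_le hx) h u

/-! ### Self-concordance along a segment. -/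

section Segment

variable {x h : V} {T : ℝ} (hΦ : IsSelfConcordant Q Φ)
  (hseg : ∀ t ∈ Icc (0 : ℝ) T, x + t • h ∈ interior Q)

include hΦ hseg

theorem primalNorm_line {t : ℝ} (ht : t ∈ Icc 0 T) :
    primalNorm (hess Φ (x + t • h)) h * (1 - t * primalNorm (hess Φ x) h) ≤
      primalNorm (hess Φ x) h ∧
    primalNorm (hess Φ x) h ≤
      primalNorm (hess Φ (x + t • h)) h * (1 + t * primalNorm (hess Φ x) h) := by
  have := sqrt_mul_le_and_le_sqrt_mul (T := T) (φ := fun t => hess Φ (x + t • h) h h)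
    (fun t ht => hΦ.hasDerivAt_hess_apply (hseg t ht) h h)
    (fun t ht => (hΦ.isPSD_hess (hseg t ht)).nonneg h)
    (fun t ht => hΦ.abs_third_le (hseg t ht) h) ht
  simpa [primalNorm] using this

/-- Lower bound for the growth of the gradient along a segment. -/
theorem grad_line_ge {t : ℝ} (ht : t ∈ Icc 0 T) :
    grad Φ x h + t * primalNorm (hess Φ x) h ^ 2 / (1 + t * primalNorm (hess Φ x) h) ≤
      grad Φ (x + t • h) h := by
  have hr := primalNorm_nonneg (hess Φ x) h
  have hl := fun t (ht : t ∈ Icc 0 T) => (primalNorm_line hΦ hseg ht).2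
  set r := primalNorm (hess Φ x) h
  refine le_of_hasDerivAt_le (T := T)
    (f := fun t => grad Φ x h + t * r ^ 2 / (1 + t * r))
    (f' := fun t => r ^ 2 / (1 + t * r) ^ 2)
    (fun τ hτ => ?_) (fun τ hτ => hΦ.hasDerivAt_grad_apply (hseg τ hτ) h) (by simp)
    (fun τ hτ => ?_) ht
  · have h1 : (0 : ℝ) < 1 + τ * r := by have := mul_nonneg hτ.1 hr; linarith
    have h2 : HasDerivAt (fun t : ℝ => t * r ^ 2) (r ^ 2) τ := by
      simpa using (hasDerivAt_id τ).mul_const (r ^ 2)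
    have h3 : HasDerivAt (fun t : ℝ => 1 + t * r) r τ := by
      simpa using ((hasDerivAt_id τ).mul_const r).const_add 1
    refine ((h2.div h3 h1.ne').const_add _).congr_deriv ?_
    ring
  · have h1 : (0 : ℝ) < 1 + τ * r := by have := mul_nonneg hτ.1 hr; linarith
    rw [div_le_iff₀ (by positivity), ← (hΦ.isPSD_hess (hseg τ hτ)).sq_primalNorm, ← mul_pow]
    exact pow_le_pow_left₀ hr (hl τ hτ) 2

/-- Upper bound for the growth of the gradient along a segment. -/
theorem grad_line_le (hT : T * primalNorm (hess Φ x) h < 1) {t : ℝ} (ht : t ∈ Icc 0 T) :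
    grad Φ (x + t • h) h ≤
      grad Φ x h + t * primalNorm (hess Φ x) h ^ 2 / (1 - t * primalNorm (hess Φ x) h) := by
  have hr := primalNorm_nonneg (hess Φ x) h
  have hl := fun t (ht : t ∈ Icc 0 T) => (primalNorm_line hΦ hseg ht).1
  set r := primalNorm (hess Φ x) h
  refine le_of_hasDerivAt_le (T := T)
    (g := fun t => grad Φ x h + t * r ^ 2 / (1 - t * r))
    (g' := fun t => r ^ 2 / (1 - t * r) ^ 2)
    (fun τ hτ => hΦ.hasDerivAt_grad_apply (hseg τ hτ) h) (fun τ hτ => ?_) (by simp)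
    (fun τ hτ => ?_) ht
  · have h1 : (0 : ℝ) < 1 - τ * r := by have := mul_le_mul_of_nonneg_right hτ.2 hr; linarith
    have h2 : HasDerivAt (fun t : ℝ => t * r ^ 2) (r ^ 2) τ := by
      simpa using (hasDerivAt_id τ).mul_const (r ^ 2)
    have h3 : HasDerivAt (fun t : ℝ => 1 - t * r) (-r) τ := by
      simpa using ((hasDerivAt_id τ).mul_const r).const_sub 1
    refine ((h2.div h3 h1.ne').const_add _).congr_deriv ?_
    ring
  · have h1 : (0 : ℝ) < 1 - τ * r := by have := mul_le_mul_of_nonneg_right hτ.2 hr; linarith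
    rw [le_div_iff₀ (by positivity), ← (hΦ.isPSD_hess (hseg τ hτ)).sq_primalNorm, ← mul_pow]
    exact pow_le_pow_left₀ (mul_nonneg (primalNorm_nonneg _ _) h1.le) (hl τ hτ) 2

/-- Upper bound for the growth of the function along a segment. -/
theorem line_le (hT : T * primalNorm (hess Φ x) h < 1) {t : ℝ} (ht : t ∈ Icc 0 T) :
    Φ (x + t • h) ≤ Φ x + t * grad Φ x h +
      (t * primalNorm (hess Φ x) h) ^ 2 / (2 * (1 - t * primalNorm (hess Φ x) h)) := by
  have hr := primalNorm_nonneg (hess Φ x) h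
  have hl := fun t (ht : t ∈ Icc 0 T) => grad_line_le hΦ hseg hT ht
  set r := primalNorm (hess Φ x) h
  refine le_of_hasDerivAt_le (T := T)
    (g := fun t => Φ x + t * grad Φ x h + (t * r) ^ 2 / (2 * (1 - t * r)))
    (g' := fun t => grad Φ x h + (2 * t * r ^ 2 - t ^ 2 * r ^ 3) / (2 * (1 - t * r) ^ 2))
    (fun τ hτ => hΦ.hasDerivAt_line (hΦ.hasFDerivAt (hseg τ hτ))) (fun τ hτ => ?_) (by simp)
    (fun τ hτ => ?_) ht
  · have h1 : (0 : ℝ) < 1 - τ * r := by have := mul_le_mul_of_nonneg_right hτ.2 hr; linarith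
    have h0 : HasDerivAt (fun t : ℝ => t * r) r τ := by
      simpa using (hasDerivAt_id τ).mul_const r
    have h4 : HasDerivAt (fun t : ℝ => Φ x + t * grad Φ x h) (grad Φ x h) τ := by
      simpa using ((hasDerivAt_id τ).mul_const (grad Φ x h)).const_add (Φ x)
    refine (h4.add ((h0.pow 2).div ((h0.const_sub 1).const_mul 2) (by positivity))).congr_deriv ?_
    field_simp
    simp only [Pi.pow_apply]
    ring
  · have h1 : (0 : ℝ) < 1 - τ * r := by have := mul_le_mul_of_nonneg_right hτ.2 hr; linarith
    refine (hl τ hτ).trans (add_le_add_right ?_ _)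
    rw [div_le_div_iff₀ h1 (by positivity)]
    have h3 : 0 ≤ τ ^ 2 * r ^ 3 * (1 - τ * r) := by have := hτ.1; positivity
    nlinarith

/-- Comparison of Hessians along a segment. -/
theorem hess_line (hT : T * primalNorm (hess Φ x) h < 1) (u : V) {t : ℝ} (ht : t ∈ Icc 0 T) :
    (1 - t * primalNorm (hess Φ x) h) ^ 3 * hess Φ (x + t • h) u u ≤ hess Φ x u u ∧
    (1 - t * primalNorm (hess Φ x) h) ^ 3 * hess Φ x u u ≤ hess Φ (x + t • h) u u := by
  have hr := primalNorm_nonneg (hess Φ x) h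
  have hl := fun t (ht : t ∈ Icc 0 T) => (primalNorm_line hΦ hseg ht).1
  set r := primalNorm (hess Φ x) h
  have hpos : ∀ τ ∈ Icc 0 T, 0 < 1 - τ * r := fun τ hτ => by
    have := mul_le_mul_of_nonneg_right hτ.2 hr; linarith
  have hd : ∀ τ ∈ Icc 0 T, HasDerivAt (fun t => (1 - t * r) ^ 3) (-(3 * (1 - τ * r) ^ 2 * r)) τ :=
    fun τ _ => by
      have h3 : HasDerivAt (fun t : ℝ => 1 - t * r) (-r) τ := by
        simpa using ((hasDerivAt_id τ).mul_const r).const_sub 1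
      refine (h3.pow 3).congr_deriv ?_
      push_cast
      ring
  -- The local norm of `h` at time `τ` is at most `r / (1 - τr)`, so the logarithmic derivative of
  -- the Hessian form is at most `3r / (1 - τr)`. Multiplying or dividing by `(1 - τr)³` therefore
  -- gives monotone functions.
  have hb : ∀ τ ∈ Icc 0 T, (1 - τ * r) * |fderiv ℝ (hess Φ) (x + τ • h) h u u| ≤
      3 * r * hess Φ (x + τ • h) u u := fun τ hτ => by
    have h1 := hΦ.abs_third_apply_le (hseg τ hτ) h u
    have h2 := mul_le_mul_of_nonneg_left h1 (hpos τ hτ).le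
    have h3 := mul_le_mul_of_nonneg_right (hl τ hτ) ((hΦ.isPSD_hess (hseg τ hτ)).nonneg u)
    linarith
  constructor
  · refine le_of_hasDerivAt_le (T := T)
      (f := fun t => (1 - t * r) ^ 3 * hess Φ (x + t • h) u u) (g := fun _ => hess Φ x u u)
      (fun τ hτ => (hd τ hτ).mul (hΦ.hasDerivAt_hess_apply (hseg τ hτ) u u))
      (fun τ hτ => hasDerivAt_const _ _) (by simp) (fun τ hτ => ?_) ht
    have h1 := hb τ hτ
    have h2 := hpos τ hτ
    have h3 := mul_le_mul_of_nonneg_left (le_abs_self (fderiv ℝ (hess Φ) (x + τ • h) h u u)) h2.le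
    have h4 := mul_le_mul_of_nonneg_left (h3.trans h1) (sq_nonneg (1 - τ * r))
    linarith
  · have h5 := le_of_hasDerivAt_le (T := T)
      (f := fun _ => hess Φ x u u) (g := fun t => hess Φ (x + t • h) u u / (1 - t * r) ^ 3)
      (fun τ hτ => hasDerivAt_const _ _)
      (fun τ hτ => (hΦ.hasDerivAt_hess_apply (hseg τ hτ) u u).div (hd τ hτ)
        (pow_pos (hpos τ hτ) 3).ne') (by simp) (fun τ hτ => ?_) ht
    · rw [le_div_iff₀ (pow_pos (hpos t ht) 3)] at h5
      linarith
    have h1 := hb τ hτ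
    have h2 := hpos τ hτ
    have h3 := mul_le_mul_of_nonneg_left
      (neg_abs_le (fderiv ℝ (hess Φ) (x + τ • h) h u u)) h2.le
    have h4 := mul_nonneg (sq_nonneg (1 - τ * r)) (by linarith :
      0 ≤ (1 - τ * r) * fderiv ℝ (hess Φ) (x + τ • h) h u u + 3 * r * hess Φ (x + τ • h) u u)
    apply div_nonneg _ (by positivity)
    linarith

end Segment

/-- The blow-up of `Φ` at the frontier excludes limit points of a set on which `Φ` is bounded. -/
theorem mem_interior_of_mem_closure (hΦ : IsSelfConcordant Q Φ) {S : Set V}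
    (hS : S ⊆ interior Q) {C : ℝ} (hC : ∀ z ∈ S, Φ z ≤ C) {z : V} (hz : z ∈ closure S) :
    z ∈ interior Q := by
  by_contra hcon
  have hf : z ∈ frontier Q := ⟨closure_mono (hS.trans interior_subset) hz, hcon⟩
  have hne : (𝓝[S] z).NeBot := mem_closure_iff_nhdsWithin_neBot.1 hz
  have ht := (hΦ.tendsto_frontier z hf).mono_left (nhdsWithin_mono z hS)
  obtain ⟨w, hw1, hw2⟩ := ((ht.eventually_gt_atTop C).and self_mem_nhdsWithin).exists
  exact absurd (hC w hw2) (not_le.2 hw1)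

theorem segment_mem (hΦ : IsSelfConcordant Q Φ) {x h : V} {T : ℝ} (hT : 0 < T)
    (hx : x ∈ interior Q) (hh : x + T • h ∈ interior Q) {t : ℝ} (ht : t ∈ Icc 0 T) :
    x + t • h ∈ interior Q := by
  have h1 : 0 ≤ 1 - t / T := sub_nonneg.2 ((div_le_one hT).2 ht.2)
  have h2 : 0 ≤ t / T := div_nonneg ht.1 hT.le
  have := hΦ.convexOn.1 hx hh h1 h2 (by ring)
  convert this using 1
  rw [smul_add, ← add_assoc, ← add_smul, smul_smul, div_mul_cancel₀ _ hT.ne']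
  simp

/-- The open Dikin ellipsoid is contained in the domain. -/
theorem add_mem_interior (hΦ : IsSelfConcordant Q Φ) {x h : V} (hx : x ∈ interior Q)
    (hh : hess Φ x h h < 1) : x + h ∈ interior Q := by
  have hr0 := primalNorm_nonneg (hess Φ x) h
  have hr : primalNorm (hess Φ x) h < 1 := by
    rw [← (hΦ.isPSD_hess hx).sq_primalNorm] at hh
    by_contra hcon
    nlinarith
  set s : Set ℝ := {t | x + t • h ∈ interior Q} with hs
  have hc : Continuous fun t : ℝ => x + t • h := by fun_prop
  have hbd : ∀ t ∈ s ∩ Icc 0 1, Φ (x + t • h) ≤ Φ x + |grad Φ x h| +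
      1 / (2 * (1 - primalNorm (hess Φ x) h)) := by
    rintro t ⟨hts, ht⟩
    rcases ht.1.eq_or_lt with h0 | h0
    · rw [← h0, zero_smul, add_zero]
      have : 0 < 1 - primalNorm (hess Φ x) h := by linarith
      have : 0 ≤ 1 / (2 * (1 - primalNorm (hess Φ x) h)) := by positivity
      have := abs_nonneg (grad Φ x h)
      linarith
    · have htr : t * primalNorm (hess Φ x) h ≤ primalNorm (hess Φ x) h :=
        mul_le_of_le_one_left hr0 ht.2
      have h1 := hΦ.line_le (fun τ hτ => hΦ.segment_mem h0 hx hts hτ) (by linarith)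
        (right_mem_Icc.2 ht.1)
      have h2 : t * grad Φ x h ≤ |grad Φ x h| := by
        refine (le_abs_self _).trans ?_
        rw [abs_mul, abs_of_pos h0]
        exact mul_le_of_le_one_left (abs_nonneg _) ht.2
      have h3 : (t * primalNorm (hess Φ x) h) ^ 2 / (2 * (1 - t * primalNorm (hess Φ x) h)) ≤
          1 / (2 * (1 - primalNorm (hess Φ x) h)) := by
        have h0' : 0 ≤ t * primalNorm (hess Φ x) h := mul_nonneg h0.le hr0
        apply div_le_div₀ zero_le_one (pow_le_one₀ h0' (by linarith)) (by linarith) (by linarith)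
      linarith
  -- Continuation in `t`: the admissible times are open since the domain is open, and closed since
  -- `Φ` stays bounded along them.
  have hsub : Icc (0 : ℝ) 1 ⊆ s := by
    apply IsClosed.Icc_subset_of_forall_mem_nhdsWithin
    · rw [← isSeqClosed_iff_isClosed]
      intro u t hu hut
      have ht : t ∈ Icc (0 : ℝ) 1 := isClosed_Icc.mem_of_tendsto hut
        (Eventually.of_forall fun n => (hu n).2)
      refine ⟨?_, ht⟩
      apply hΦ.mem_interior_of_mem_closure (S := (fun t : ℝ => x + t • h) '' (s ∩ Icc 0 1))
        (C := Φ x + |grad Φ x h| + 1 / (2 * (1 - primalNorm (hess Φ x) h)))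
      · rintro _ ⟨t, ht, rfl⟩; exact ht.1
      · rintro _ ⟨t, ht, rfl⟩; exact hbd t ht
      · exact mem_closure_of_tendsto ((hc.tendsto t).comp hut)
          (Eventually.of_forall fun n => mem_image_of_mem _ (hu n))
    · simpa [hs] using hx
    · intro t ht
      exact nhdsWithin_le_nhds ((isOpen_interior.preimage hc).mem_nhds ht.1)
  simpa [hs] using hsub (right_mem_Icc.2 zero_le_one)

section Unit

variable {x h : V} (hΦ : IsSelfConcordant Q Φ) (hx : x ∈ interior Q)
  (hxh : x + h ∈ interior Q)

include hΦ hx hxh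

theorem segment_mem_one : ∀ t ∈ Icc (0 : ℝ) 1, x + t • h ∈ interior Q := fun _ ht =>
  hΦ.segment_mem one_pos hx (by simpa using hxh) ht

theorem grad_sub_ge :
    primalNorm (hess Φ x) h ^ 2 / (1 + primalNorm (hess Φ x) h) ≤
      grad Φ (x + h) h - grad Φ x h := by
  have := hΦ.grad_line_ge (segment_mem_one hΦ hx hxh) (right_mem_Icc.2 zero_le_one)
  simp only [one_mul, one_smul] at this
  linarith

theorem add_le (hr : primalNorm (hess Φ x) h < 1) :
    Φ (x + h) ≤ Φ x + grad Φ x h +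
      primalNorm (hess Φ x) h ^ 2 / (2 * (1 - primalNorm (hess Φ x) h)) := by
  have := hΦ.line_le (segment_mem_one hΦ hx hxh) (by simpa using hr) (right_mem_Icc.2 zero_le_one)
  simpa using this

theorem hess_add (hr : primalNorm (hess Φ x) h < 1) (u : V) :
    (1 - primalNorm (hess Φ x) h) ^ 3 * hess Φ (x + h) u u ≤ hess Φ x u u ∧
    (1 - primalNorm (hess Φ x) h) ^ 3 * hess Φ x u u ≤ hess Φ (x + h) u u := by
  have := hΦ.hess_line (segment_mem_one hΦ hx hxh) (by simpa using hr) u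
    (right_mem_Icc.2 zero_le_one)
  simpa using this

end Unit

/-- A bound of the displacement of the gradient in the dual local norm: if `⟨∇Φ(z) - ∇Φ(x), h⟩`
is small for `z = x + h`, then `∇Φ(z) - ∇Φ(x)` is small. -/
theorem sq_dualNorm_grad_sub_le [FiniteDimensional ℝ V] (hΦ : IsSelfConcordant Q Φ) {x z : V}
    (hx : x ∈ interior Q) (hz : z ∈ interior Q) (hM : IsPD (hess Φ x)) :
    dualNorm (hess Φ x) (grad Φ z - grad Φ x) ^ 2 /
        (2 * (1 + dualNorm (hess Φ x) (grad Φ z - grad Φ x))) ≤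
      (grad Φ z - grad Φ x) (z - x) := by
  set d := grad Φ z - grad Φ x with hd
  have hq := dualNorm_nonneg (hess Φ x) d
  set q := dualNorm (hess Φ x) d with hqd
  have hw : d ((hess Φ x).inverse d) = q ^ 2 := (hM.sq_dualNorm d).symm
  have hwn : primalNorm (hess Φ x) ((hess Φ x).inverse d) = q := (hM.dualNorm_eq d).symm
  set w := (hess Φ x).inverse d
  -- A damped Newton-type step of local length `q/(1 + q) < 1`. The upper bound for `Φ(x + h)` is
  -- played against the lower bound through the tangent plane at `z`. This gives `⟨d, h⟩ -
  -- q²/(2(1+q)) ≤ ⟨d, z - x⟩`, where `⟨d, h⟩ = q²/(1+q)`.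
  set h := (1 + q)⁻¹ • w with hh
  have hn : primalNorm (hess Φ x) h = q / (1 + q) := by
    rw [hh, primalNorm_smul, hwn, abs_of_pos (by positivity)]
    field_simp
  have hlt : primalNorm (hess Φ x) h < 1 := by
    rw [hn, div_lt_one (by positivity)]; linarith
  have hxh : x + h ∈ interior Q := hΦ.add_mem_interior hx (by
    rw [← hM.sq_primalNorm]
    exact pow_lt_one₀ (primalNorm_nonneg _ _) hlt two_ne_zero)
  have h1 := hΦ.add_le hx hxh hlt
  have h2 := hΦ.grad_sub_le hz hxh
  have h3 := hΦ.grad_sub_le hx hz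
  have h4 : d h = q ^ 2 / (1 + q) := by
    rw [hh, map_smul, hw, smul_eq_mul]; field_simp
  have h5 : primalNorm (hess Φ x) h ^ 2 / (2 * (1 - primalNorm (hess Φ x) h)) =
      q ^ 2 / (2 * (1 + q)) := by
    rw [hn]; field_simp; ring
  have h6 : q ^ 2 / (1 + q) = 2 * (q ^ 2 / (2 * (1 + q))) := by field_simp
  have e1 : grad Φ z (x + h - z) = grad Φ z h - grad Φ z (z - x) := by
    rw [← map_sub]; congr 1; abel
  rw [h5] at h1
  rw [e1] at h2
  simp only [hd, sub_apply] at h4 ⊢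
  linarith

end IsSelfConcordant

/-! ### Normal barriers of regular cones -/

section Cone

open scoped Pointwise

variable {V : Type*} [NormedAddCommGroup V] [NormedSpace ℝ V] (K : ProperCone ℝ V)

omit K in
theorem smul_mem_interior_of_smul_mem {S : Set V} {τ : ℝ} (hτ : 0 < τ) (hS : ∀ x ∈ S, τ • x ∈ S)
    {x : V} (hx : x ∈ interior S) : τ • x ∈ interior S := by
  have h1 : IsOpen (τ • interior S) := isOpen_interior.smul₀ hτ.ne'
  have h2 : τ • interior S ⊆ S := by
    rintro _ ⟨z, hz, rfl⟩
    exact hS z (interior_subset hz)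
  exact interior_maximal h2 h1 (Set.smul_mem_smul_set hx)

theorem smul_mem_interior_cone {x : V} (hx : x ∈ interior (K : Set V)) {τ : ℝ} (hτ : 0 < τ) :
    τ • x ∈ interior (K : Set V) :=
  smul_mem_interior_of_smul_mem hτ (fun _ hz => K.smul_mem hz hτ.le) hx

theorem add_mem_interior_cone {x v : V} (hx : x ∈ interior (K : Set V)) (hv : v ∈ K) :
    x + v ∈ interior (K : Set V) := by
  have h1 : IsOpen (interior (K : Set V) + {v}) := isOpen_interior.add_right
  have h2 : interior (K : Set V) + {v} ⊆ K := by
    rintro _ ⟨z, hz, w, rfl, rfl⟩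
    exact K.add_mem (interior_subset hz) hv
  exact interior_maximal h2 h1 (Set.add_mem_add hx rfl)

/-- An interior point of the dual cone is bounded below by a multiple of the norm. -/
theorem exists_pos_mul_norm_le {s : StrongDual ℝ V} (hs : s ∈ interior (dualCone K)) :
    ∃ ε > 0, ∀ x ∈ K, ε * ‖x‖ ≤ s x := by
  obtain ⟨r, hr, hball⟩ := Metric.isOpen_iff.1 isOpen_interior s hs
  refine ⟨r / 2, by positivity, fun x hx => ?_⟩
  obtain ⟨g, hg, hgx⟩ := exists_dual_vector'' ℝ x
  have : s - (r / 2) • g ∈ dualCone K := by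
    apply interior_subset
    apply hball
    rw [Metric.mem_ball, dist_eq_norm, sub_sub_cancel_left, norm_neg, norm_smul, Real.norm_eq_abs,
      abs_of_pos (by positivity)]
    nlinarith
  have h := this x hx
  simp only [sub_apply, smul_apply, smul_eq_mul, hgx] at h
  simpa using h

theorem smul_mem_interior_dualCone {s : StrongDual ℝ V} (hs : s ∈ interior (dualCone K)) {τ : ℝ}
    (hτ : 0 < τ) : τ • s ∈ interior (dualCone K) :=
  smul_mem_interior_of_smul_mem (S := dualCone K) hτ
    (fun _ ht x hx => mul_nonneg hτ.le (ht x hx)) hs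

theorem convex_dualCone : Convex ℝ (dualCone K) := by
  intro s hs t ht a b ha hb _ x hx
  have h1 := mul_nonneg ha (hs x hx)
  have h2 := mul_nonneg hb (ht x hx)
  simp only [add_apply, smul_apply, smul_eq_mul]
  linarith

end Cone

namespace IsNormalBarrier

variable {V : Type*} [NormedAddCommGroup V] [NormedSpace ℝ V] {K : ProperCone ℝ V} {ν : ℝ}
  {F : V → ℝ} (hF : IsNormalBarrier K ν F)

include hF

theorem grad_smul {x : V} (hx : x ∈ interior (K : Set V)) {τ : ℝ} (hτ : 0 < τ) :
    grad F (τ • x) = τ⁻¹ • grad F x := by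
  have h1 : HasFDerivAt (fun z : V => F (τ • z)) (τ • grad F (τ • x)) x := by
    have := (hF.selfConcordant.hasFDerivAt (smul_mem_interior_cone K hx hτ)).comp x
      ((hasFDerivAt_id x).const_smul τ)
    refine this.congr_fderiv ?_
    ext u
    simp
  have h2 : HasFDerivAt (fun z : V => F (τ • z)) (grad F x) x := by
    refine ((hF.selfConcordant.hasFDerivAt hx).sub_const (ν * Real.log τ)).congr_of_eventuallyEq ?_
    filter_upwards [isOpen_interior.mem_nhds hx] with z hz using hF.logHomogeneous z hz τ hτ
  rw [← h1.unique h2, smul_smul, inv_mul_cancel₀ hτ.ne', one_smul]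

theorem grad_self {x : V} (hx : x ∈ interior (K : Set V)) : grad F x x = -ν := by
  have h1 := hF.selfConcordant.hasDerivAt_line (x := x) (h := x) (t := 0)
    (hF.selfConcordant.hasFDerivAt (by simpa using hx))
  rw [zero_smul, add_zero] at h1
  have h2 : HasDerivAt (fun t : ℝ => F (x + t • x)) (-ν) 0 := by
    have h3 : HasDerivAt (fun t : ℝ => F x - ν * Real.log (1 + t)) (-ν) 0 := by
      have := (((hasDerivAt_id (0 : ℝ)).const_add 1).log (by simp)).const_mul ν
      simpa using this.const_sub (F x)
    refine h3.congr_of_eventuallyEq ?_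
    filter_upwards [Ioi_mem_nhds (show (-1 : ℝ) < 0 by norm_num)] with t ht
    have ht : (-1 : ℝ) < t := ht
    rw [← hF.logHomogeneous x hx (1 + t) (by linarith), add_smul, one_smul]
  exact h1.unique h2

/-- Euler's relation for the gradient, which is homogeneous of degree `-1`. It is what makes the
prediction error an exact expression in `s_*`. -/
theorem hess_self {x : V} (hx : x ∈ interior (K : Set V)) : hess F x x = -grad F x := by
  ext u
  have h1 := hF.selfConcordant.hasDerivAt_grad_apply (x := x) (h := x) (t := 0)
    (by simpa using hx) u
  rw [zero_smul, add_zero] at h1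
  have h2 : HasDerivAt (fun t : ℝ => grad F (x + t • x) u) (-grad F x u) 0 := by
    have h3 : HasDerivAt (fun t : ℝ => (1 + t)⁻¹ * grad F x u) (-grad F x u) 0 := by
      have := (((hasDerivAt_id (0 : ℝ)).const_add 1).inv (by simp)).mul_const (grad F x u)
      simpa using this
    refine h3.congr_of_eventuallyEq ?_
    filter_upwards [Ioi_mem_nhds (show (-1 : ℝ) < 0 by norm_num)] with t ht
    have ht : (-1 : ℝ) < t := ht
    have := hF.grad_smul hx (τ := 1 + t) (by linarith)
    rw [add_smul, one_smul] at this
    rw [this]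
    simp
  exact h1.unique h2

theorem hess_self_self {x : V} (hx : x ∈ interior (K : Set V)) : hess F x x x = ν := by
  rw [hF.hess_self hx, neg_apply, hF.grad_self hx, neg_neg]

theorem nonneg {x : V} (hx : x ∈ interior (K : Set V)) : 0 ≤ ν := by
  rw [← hF.hess_self_self hx]
  exact (hF.selfConcordant.isPSD_hess hx).nonneg x

/-- For interior `v`, the tangent plane at `x` evaluated at `τv` grows linearly in `τ`, while
`F(τv)` does not increase for `τ ≥ 1`. For general `v` the bound is applied to the interior points
`x + tv` with `t` large. -/
theorem grad_apply_nonpos {x v : V} (hx : x ∈ interior (K : Set V)) (hv : v ∈ K) :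
    grad F x v ≤ 0 := by
  have hint : ∀ v ∈ interior (K : Set V), grad F x v ≤ 0 := fun v hv => by
    have hν := hF.nonneg hx
    have key : ∀ τ : ℝ, 1 ≤ τ → τ * grad F x v ≤ F v - F x - ν := fun τ hτ => by
      have h1 := hF.selfConcordant.grad_sub_le hx
        (smul_mem_interior_cone K hv (by linarith : (0 : ℝ) < τ))
      rw [hF.logHomogeneous v hv τ (by linarith), map_sub, map_smul, hF.grad_self hx,
        smul_eq_mul] at h1
      have h2 := mul_nonneg hν (Real.log_nonneg hτ)
      linarith
    by_contra! hcon
    have h3 := key (1 + |F v - F x - ν| / grad F x v) (by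
      have := div_nonneg (abs_nonneg (F v - F x - ν)) hcon.le
      linarith)
    rw [add_mul, div_mul_cancel₀ _ hcon.ne'] at h3
    linarith [le_abs_self (F v - F x - ν)]
  have key : ∀ t : ℝ, 0 ≤ t → t * grad F x v ≤ ν := fun t ht => by
    have := hint _ (add_mem_interior_cone K hx (K.smul_mem hv ht))
    rw [map_add, map_smul, hF.grad_self hx, smul_eq_mul] at this
    linarith
  by_contra! hcon
  have h3 := key ((|ν| + 1) / grad F x v) (by positivity)
  rw [div_mul_cancel₀ _ hcon.ne'] at h3
  linarith [le_abs_self ν]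

/-- Along the ray `x + tv`, which never leaves the cone, the slope stays nonpositive, yet it
increases by at least `tr²/(1 + tr)`, which tends to `r`. -/
theorem primalNorm_le {x v : V} (hx : x ∈ interior (K : Set V)) (hv : v ∈ K) :
    primalNorm (hess F x) v ≤ -grad F x v := by
  have hr := primalNorm_nonneg (hess F x) v
  have hc := hF.grad_apply_nonpos hx hv
  set r := primalNorm (hess F x) v with hrd
  have hmem : ∀ t : ℝ, 0 ≤ t → x + t • v ∈ interior (K : Set V) := fun t ht =>
    add_mem_interior_cone K hx (K.smul_mem hv ht)
  have key : ∀ t : ℝ, 0 ≤ t → t * r ^ 2 ≤ -grad F x v * (1 + t * r) := fun t ht => by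
    have h1 := hF.selfConcordant.grad_line_ge (T := t) (fun τ hτ => hmem τ hτ.1)
      (right_mem_Icc.2 ht)
    have h2 := hF.grad_apply_nonpos (hmem t ht) hv
    rw [← hrd] at h1
    have h3 : t * r ^ 2 / (1 + t * r) ≤ -grad F x v := by linarith
    rwa [div_le_iff₀ (by positivity)] at h3
  set c := -grad F x v
  have hc' : 0 ≤ c := neg_nonneg.2 hc
  by_contra! hcon
  have hr0 : 0 < r := by linarith
  have hd : 0 < r * (r - c) := mul_pos hr0 (by linarith)
  -- For this `t` one has `t · r(r - c) = c + 1`, exceeding the bound `c` implied by `key`.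
  have h1 := key ((c + 1) / (r * (r - c))) (by positivity)
  have h2 : (c + 1) / (r * (r - c)) * (r * (r - c)) = c + 1 := div_mul_cancel₀ _ hd.ne'
  nlinarith

/-- A degenerate direction has its whole line through `x` in the Dikin ellipsoid, hence in `K`; its
recession directions `±h` then lie in `K`, contradicting pointedness unless `h = 0`. -/
theorem isPD_hess (hK : IsRegularCone K) {x : V} (hx : x ∈ interior (K : Set V)) :
    IsPD (hess F x) := by
  refine ⟨hF.selfConcordant.isPSD_hess hx, fun h hh => ?_⟩
  have hmem : ∀ h : V, hess F x h h = 0 → h ∈ K := fun h hh => by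
    have h1 : ∀ n : ℕ, (1 / ((n : ℝ) + 1)) • x + h ∈ (K : Set V) := fun n => by
      have h2 : x + ((n : ℝ) + 1) • h ∈ (K : Set V) := interior_subset
        (hF.selfConcordant.add_mem_interior hx (by simp [hh]))
      have h3 : (0 : ℝ) < (n : ℝ) + 1 := by positivity
      have h4 := K.smul_mem h2 (show (0 : ℝ) ≤ 1 / ((n : ℝ) + 1) by positivity)
      rwa [smul_add, smul_smul, one_div_mul_cancel h3.ne', one_smul] at h4
    have h2 : Tendsto (fun n : ℕ => (1 / ((n : ℝ) + 1)) • x + h) atTop (𝓝 h) := by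
      simpa using ((tendsto_one_div_add_atTop_nhds_zero_nat (𝕜 := ℝ)).smul_const x).add_const h
    exact K.isClosed.mem_of_tendsto h2 (Eventually.of_forall h1)
  exact hK.salient h (hmem h hh) (hmem (-h) (by simpa using hh))

theorem grad_injOn (hK : IsRegularCone K) : InjOn (grad F) (interior (K : Set V)) := by
  intro x hx z hz hxz
  have h1 := hF.selfConcordant.grad_sub_ge hx (h := z - x) (by simpa using hz)
  have h2 := primalNorm_nonneg (hess F x) (z - x)
  rw [add_sub_cancel, hxz, sub_self, div_le_iff₀ (by positivity), zero_mul] at h1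
  have h3 := (hF.isPD_hess hK hx).eq_zero (z - x) (by
    rw [← (hF.isPD_hess hK hx).sq_primalNorm]
    exact le_antisymm h1 (sq_nonneg _))
  exact (sub_eq_zero.1 h3).symm

/-- The Hessians at two points of the cone are comparable. -/
theorem primalNorm_hess_le {x u : V} (hx : x ∈ interior (K : Set V))
    (hu : u ∈ interior (K : Set V)) (h : V) :
    primalNorm (hess F x) h ≤ -grad F x u * primalNorm (hess F u) h := by
  have hP := hF.selfConcordant.isPSD_hess hx
  -- Both `u + w` and `u - w` lie in `K`. Writing `2w` as their difference and adding the two bounds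
  -- by `-∇F(x)` cancels `w` on the right.
  have hball : ∀ w, hess F u w w < 1 → primalNorm (hess F x) w ≤ -grad F x u := fun w hw => by
    have h1 := hF.primalNorm_le hx (interior_subset (hF.selfConcordant.add_mem_interior hu hw))
    have h2 := hF.primalNorm_le hx (interior_subset
      (hF.selfConcordant.add_mem_interior hu (h := -w) (by simpa using hw)))
    have h3 := hP.primalNorm_add_le (u + w) (-(u + -w))
    have h4 : primalNorm (hess F x) (-(u + -w)) = primalNorm (hess F x) (u + -w) := by
      have := primalNorm_smul (hess F x) (-1) (u + -w)
      rwa [neg_one_smul, abs_neg, abs_one, one_mul] at this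
    have h5 : u + w + -(u + -w) = (2 : ℝ) • w := by module
    rw [h5, primalNorm_smul, h4, abs_of_pos two_pos] at h3
    simp only [map_add, map_neg] at h1 h2
    linarith
  have h1 := (hF.selfConcordant.isPSD_hess hu).le_mul_primalNorm (hess F x h)
    (C := primalNorm (hess F x) h * -grad F x u) (fun w hw => (hP.apply_le h w).trans
      (mul_le_mul_of_nonneg_left (hball w hw) (primalNorm_nonneg _ _))) h
  rw [← hP.sq_primalNorm] at h1
  have h2 := primalNorm_nonneg (hess F x) h
  have h3 : 0 ≤ -grad F x u * primalNorm (hess F u) h := mul_nonneg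
    (neg_nonneg.2 (hF.grad_apply_nonpos hx (interior_subset hu))) (primalNorm_nonneg _ _)
  by_contra! hcon
  nlinarith

section FiniteDimensional

variable [FiniteDimensional ℝ V] (hK : IsRegularCone K)

include hK

/-- Nonnegativity of `s` at `u - h`, for every `h` in the Dikin ellipsoid, says `⟨s, h⟩ ≤ ⟨s, u⟩`.
-/
theorem dualNorm_le_apply {s : StrongDual ℝ V} (hs : s ∈ dualCone K) {u : V}
    (hu : u ∈ interior (K : Set V)) : dualNorm (hess F u) s ≤ s u := by
  have hP := hF.isPD_hess hK hu
  refine hP.dualNorm_le (hs u (interior_subset hu)) (hP.le_mul_primalNorm s fun h hh => ?_)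
  have := hs _ (interior_subset
    (hF.selfConcordant.add_mem_interior hu (h := -h) (by simpa using hh)))
  simp only [map_add, map_neg] at this
  linarith

/-- The Dikin ellipsoid of the dual barrier is contained in the dual cone. -/
theorem neg_grad_add_mem_dualCone {x : V} (hx : x ∈ interior (K : Set V)) {δ : StrongDual ℝ V}
    (hδ : dualNorm (hess F x) δ ≤ 1) : -grad F x + δ ∈ dualCone K := by
  intro v hv
  have h1 := hF.primalNorm_le hx hv
  have h2 := (hF.isPD_hess hK hx).apply_le_dualNorm (-δ) v
  have h3 : dualNorm (hess F x) (-δ) = dualNorm (hess F x) δ := by simp [dualNorm]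
  have h4 := mul_le_mul_of_nonneg_right hδ (primalNorm_nonneg (hess F x) v)
  simp only [neg_apply, add_apply, h3] at h2 ⊢
  linarith

theorem neg_grad_mem_interior {x : V} (hx : x ∈ interior (K : Set V)) :
    -grad F x ∈ interior (dualCone K) := by
  rw [mem_interior_iff_mem_nhds]
  have hc : Continuous fun s : StrongDual ℝ V => dualNorm (hess F x) (s - -grad F x) := by
    unfold dualNorm; fun_prop
  have := hc.continuousAt.eventually_lt (x₀ := -grad F x) continuousAt_const
    (show dualNorm (hess F x) (-grad F x - -grad F x) < 1 by simp [dualNorm])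
  filter_upwards [this] with s hs
  simpa using hF.neg_grad_add_mem_dualCone hK hx hs.le

omit hK in
/-- Minimization of `⟨s, x⟩ + F(x)` over an affine section of the cone. -/
theorem exists_grad_add_apply_eq_zero {s : StrongDual ℝ V} (hs : s ∈ interior (dualCone K))
    {x₀ : V} (hx₀ : x₀ ∈ interior (K : Set V)) (W : Submodule ℝ V) :
    ∃ x ∈ interior (K : Set V), x - x₀ ∈ W ∧ ∀ w ∈ W, grad F x w + s w = 0 := by
  obtain ⟨ε, hε, hsε⟩ := exists_pos_mul_norm_le K hs
  -- Far out on the ray through `x₀` the gradient is as small as desired. The tangent plane at such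
  -- a `z` costs at most half of the growth `ε‖x‖` of `s`, which makes `s + F` coercive on the cone.
  obtain ⟨z, hz, hgz⟩ : ∃ z ∈ interior (K : Set V), ‖grad F z‖ ≤ ε / 2 := by
    have hτ : 0 < 2 * ‖grad F x₀‖ / ε + 1 := by positivity
    refine ⟨_, smul_mem_interior_cone K hx₀ hτ, ?_⟩
    rw [hF.grad_smul hx₀ hτ, norm_smul, norm_inv, Real.norm_eq_abs, abs_of_pos hτ,
      inv_mul_le_iff₀ hτ]
    have : 2 * ‖grad F x₀‖ / ε * ε = 2 * ‖grad F x₀‖ := div_mul_cancel₀ _ hε.ne'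
    nlinarith
  set C := s x₀ + F x₀ with hC
  set S : Set V := {x | x ∈ interior (K : Set V) ∧ x - x₀ ∈ W ∧ s x + F x ≤ C} with hS
  have hcont : ContinuousOn (fun x => s x + F x) (interior (K : Set V)) :=
    s.continuous.continuousOn.add hF.selfConcordant.contDiffOn.continuousOn
  have hFle : ∀ x ∈ S, F x ≤ C := fun x hx => by
    have := interior_subset hs x (interior_subset hx.1)
    linarith [hx.2.2]
  have hbdd : Bornology.IsBounded S := by
    refine (Metric.isBounded_closedBall (x := (0 : V))
      (r := (C - F z + grad F z z) * 2 / ε)).subset fun x hx => ?_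
    rw [mem_closedBall_zero_iff, le_div_iff₀ hε]
    have h1 := hsε x (interior_subset hx.1)
    have h2 := hF.selfConcordant.grad_sub_le hz hx.1
    have h3 : -(ε / 2 * ‖x‖) ≤ grad F z x := by
      have h4 := (grad F z).le_opNorm x
      have h5 := mul_le_mul_of_nonneg_right hgz (norm_nonneg x)
      have h6 := neg_abs_le (grad F z x)
      rw [Real.norm_eq_abs] at h4
      linarith
    rw [map_sub] at h2
    have := hx.2.2
    linarith
  have hclosed : IsClosed S := by
    rw [← closure_subset_iff_isClosed]
    intro x hx
    have hxi := hF.selfConcordant.mem_interior_of_mem_closure (fun _ h => h.1) hFle hx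
    refine ⟨hxi, ?_, ?_⟩
    · have hW : IsClosed {x : V | x - x₀ ∈ W} :=
        W.closed_of_finiteDimensional.preimage (continuous_id.sub continuous_const)
      exact closure_minimal (fun _ h => h.2.1) hW hx
    · have hne : (𝓝[S] x).NeBot := mem_closure_iff_nhdsWithin_neBot.1 hx
      have ht : Tendsto (fun x => s x + F x) (𝓝[S] x) (𝓝 (s x + F x)) :=
        (hcont.continuousAt (isOpen_interior.mem_nhds hxi)).tendsto.mono_left nhdsWithin_le_nhds
      exact le_of_tendsto ht (by filter_upwards [self_mem_nhdsWithin] with w hw using hw.2.2)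
  obtain ⟨x, hxS, hmin⟩ := (Metric.isCompact_of_isClosed_isBounded hclosed hbdd).exists_isMinOn
    ⟨x₀, hx₀, by simp, le_rfl⟩ (hcont.mono fun _ h => h.1)
  refine ⟨x, hxS.1, hxS.2.1, fun w hw => ?_⟩
  have hd : HasDerivAt (fun t : ℝ => s (x + t • w) + F (x + t • w)) (s w + grad F x w) 0 := by
    have h1 := hF.selfConcordant.hasDerivAt_line (x := x) (h := w) (t := 0) (f := s)
      s.hasFDerivAt
    have h2 := hF.selfConcordant.hasDerivAt_line (x := x) (h := w) (t := 0)
      (hF.selfConcordant.hasFDerivAt (by simpa using hxS.1))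
    exact (h1.add h2).congr_deriv (by simp)
  have hloc : IsLocalMin (fun t : ℝ => s (x + t • w) + F (x + t • w)) 0 := by
    have hc : ContinuousAt (fun τ : ℝ => x + τ • w) 0 := by fun_prop
    filter_upwards [hc.eventually_mem (isOpen_interior.mem_nhds (by simpa using hxS.1))] with t ht
    simp only [zero_smul, add_zero]
    by_cases hle : s (x + t • w) + F (x + t • w) ≤ C
    · refine hmin ⟨ht, ?_, hle⟩
      rw [add_sub_right_comm]
      exact W.add_mem hxS.2.1 (W.smul_mem t hw)
    · exact hxS.2.2.trans (not_le.1 hle).le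
  have := hloc.hasDerivAt_eq_zero hd
  linarith

theorem exists_grad_eq {s : StrongDual ℝ V} (hs : s ∈ interior (dualCone K)) :
    ∃ x ∈ interior (K : Set V), grad F x = -s := by
  obtain ⟨x₀, hx₀⟩ := hK.interior_nonempty
  obtain ⟨x, hx, -, h⟩ := hF.exists_grad_add_apply_eq_zero hs hx₀ ⊤
  exact ⟨x, hx, by ext w; have := h w trivial; simp only [neg_apply]; linarith⟩

end FiniteDimensional

end IsNormalBarrier

/-! ### The dual barrier -/

section DualBarrier

variable {V : Type*} [NormedAddCommGroup V] [NormedSpace ℝ V]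

/-- The solution `x ∈ int K` of `∇F(x) = -s`. -/
def conjugatePoint (K : ProperCone ℝ V) (F : V → ℝ) (s : StrongDual ℝ V) : V :=
  Classical.epsilon fun x => x ∈ interior (K : Set V) ∧ grad F x = -s

namespace IsNormalBarrier

variable [FiniteDimensional ℝ V] {K : ProperCone ℝ V} {ν : ℝ}
  {F : V → ℝ} (hF : IsNormalBarrier K ν F) (hK : IsRegularCone K)

include hF hK

theorem conjugatePoint_mem {s : StrongDual ℝ V} (hs : s ∈ interior (dualCone K)) :
    conjugatePoint K F s ∈ interior (K : Set V) :=
  (Classical.epsilon_spec (hF.exists_grad_eq hK hs)).1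

theorem grad_conjugatePoint {s : StrongDual ℝ V} (hs : s ∈ interior (dualCone K)) :
    grad F (conjugatePoint K F s) = -s :=
  (Classical.epsilon_spec (hF.exists_grad_eq hK hs)).2

omit [FiniteDimensional ℝ V] in
theorem eq_conjugatePoint {x : V} (hx : x ∈ interior (K : Set V)) {s : StrongDual ℝ V}
    (hxs : grad F x = -s) : x = conjugatePoint K F s := by
  have h := Classical.epsilon_spec
    (p := fun x => x ∈ interior (K : Set V) ∧ grad F x = -s) ⟨x, hx, hxs⟩
  exact hF.grad_injOn hK hx h.1 (hxs.trans h.2.symm)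

/-- The inverse function theorem gives a local inverse of `∇F`; injectivity of `∇F` on `int K`
identifies it with the conjugate point. -/
theorem hasFDerivAt_conjugatePoint {s : StrongDual ℝ V} (hs : s ∈ interior (dualCone K)) :
    HasFDerivAt (conjugatePoint K F) (-(hess F (conjugatePoint K F s)).inverse) s := by
  have : CompleteSpace V := FiniteDimensional.complete ℝ V
  set x := conjugatePoint K F s with hx
  have hxK : x ∈ interior (K : Set V) := hF.conjugatePoint_mem hK hs
  have hgx : grad F x = -s := hF.grad_conjugatePoint hK hs
  obtain ⟨e, he⟩ := (hF.isPD_hess hK hxK).isInvertible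
  have hstrict : HasStrictFDerivAt (grad F) (e : V →L[ℝ] StrongDual ℝ V) x := by
    rw [he]
    exact (hF.selfConcordant.contDiffAt_grad hxK).hasStrictFDerivAt (by norm_num)
  have hinv := hstrict.to_localInverse.hasFDerivAt
  rw [hgx] at hinv
  have hneg : HasFDerivAt (fun p : StrongDual ℝ V => -p)
      (-ContinuousLinearMap.id ℝ (StrongDual ℝ V)) s := (hasFDerivAt_id s).neg
  have hcomp := hinv.comp s hneg
  rw [← he, ContinuousLinearMap.inverse_equiv]
  refine (hcomp.congr_fderiv (by ext; simp)).congr_of_eventuallyEq ?_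
  have hcont : Tendsto (fun p : StrongDual ℝ V => -p) (𝓝 s) (𝓝 (grad F x)) := by
    rw [hgx]; exact tendsto_id.neg
  have h1 := hcont.eventually hstrict.eventually_right_inverse
  have h2 := hcont.eventually (hstrict.localInverse_continuousAt.eventually_mem (by
    rw [hstrict.localInverse_apply_image]
    exact isOpen_interior.mem_nhds hxK))
  filter_upwards [h1, h2] with p hp1 hp2
  exact (hF.eq_conjugatePoint hK hp2 hp1).symm

theorem dualBarrier_eq {s : StrongDual ℝ V} (hs : s ∈ interior (dualCone K)) :
    dualBarrier K F s = -(s (conjugatePoint K F s)) - F (conjugatePoint K F s) := by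
  have hx := hF.conjugatePoint_mem hK hs
  refine IsGreatest.csSup_eq ⟨mem_image_of_mem _ hx, ?_⟩
  rintro _ ⟨z, hz, rfl⟩
  have := hF.selfConcordant.grad_sub_le hx hz
  rw [hF.grad_conjugatePoint hK hs, neg_apply, map_sub] at this
  dsimp only
  linarith

/-- Envelope argument: the terms containing the derivative of the maximizer cancel by `∇F(x) = -s`.
-/
theorem hasFDerivAt_dualBarrier {s : StrongDual ℝ V} (hs : s ∈ interior (dualCone K)) :
    HasFDerivAt (dualBarrier K F)
      (-(NormedSpace.inclusionInDoubleDual ℝ V (conjugatePoint K F s))) s := by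
  have hx := hF.hasFDerivAt_conjugatePoint hK hs
  have h1 := ((hasFDerivAt_id s).clm_apply hx).neg.sub
    ((hF.selfConcordant.hasFDerivAt (hF.conjugatePoint_mem hK hs)).comp s hx)
  refine (h1.congr_fderiv ?_).congr_of_eventuallyEq ?_
  · ext t
    simp [hF.grad_conjugatePoint hK hs]
  · filter_upwards [isOpen_interior.mem_nhds hs] with p hp using hF.dualBarrier_eq hK hp

theorem hess_dualBarrier {s : StrongDual ℝ V} (hs : s ∈ interior (dualCone K)) :
    hess (dualBarrier K F) s = (NormedSpace.inclusionInDoubleDual ℝ V).comp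
      (hess F (conjugatePoint K F s)).inverse := by
  have h0 : HasFDerivAt (fun x : V => NormedSpace.inclusionInDoubleDual ℝ V x)
      (NormedSpace.inclusionInDoubleDual ℝ V) (conjugatePoint K F s) :=
    ContinuousLinearMap.hasFDerivAt _
  have h1 := (HasFDerivAt.comp (E := StrongDual ℝ V) (F := V) (G := StrongDual ℝ (StrongDual ℝ V))
    (f := conjugatePoint K F) s h0 (hF.hasFDerivAt_conjugatePoint hK hs)).neg
  refine HasFDerivAt.fderiv ((h1.congr_fderiv ?_).congr_of_eventuallyEq ?_)
  · ext; simp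
  · filter_upwards [isOpen_interior.mem_nhds hs] with p hp
      using (hF.hasFDerivAt_dualBarrier hK hp).fderiv

theorem hessDual_dualBarrier {s : StrongDual ℝ V} (hs : s ∈ interior (dualCone K)) :
    hessDual (dualBarrier K F) s = (hess F (conjugatePoint K F s)).inverse := by
  ext t
  rw [hessDual, hF.hess_dualBarrier hK hs]
  exact (bidualEquiv V).symm_apply_apply _

end IsNormalBarrier

end DualBarrier

/-! ### The dual feasible set and its barrier -/

namespace Problem

variable {E H : Type*} [NormedAddCommGroup E] [NormedSpace ℝ E] [FiniteDimensional ℝ E]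
  [NormedAddCommGroup H] [NormedSpace ℝ H] {P : Problem E H} {ν : ℝ}

omit [FiniteDimensional ℝ E] in
theorem adj_apply (P : Problem E H) (y : H) (x : E) : P.adj y x = P.A x y := rfl

omit [FiniteDimensional ℝ E] in
-- Moving from `y` slightly away from `y₀` stays in `Q`, so `s(y)` is a convex combination, with
-- positive weight on the interior point `s₀`, of two points of the dual cone.
theorem slack_mem_interior (hstrict : P.StrictlyFeasible) {y : H} (hy : y ∈ interior P.Q) :
    P.slack y ∈ interior (dualCone P.K) := by
  obtain ⟨-, s₀, hs₀, y₀, hy₀⟩ := hstrict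
  have hc : ContinuousAt (fun t : ℝ => y + t • (y - y₀)) 0 := by fun_prop
  have hev := (hc.eventually_mem (isOpen_interior.mem_nhds (by simpa using hy))).filter_mono
    (nhdsWithin_le_nhds (s := Ioi 0))
  obtain ⟨t, ht, ht0⟩ := (hev.and self_mem_nhdsWithin).exists
  have ht0 : (0 : ℝ) < t := ht0
  have h1 : P.slack (y + t • (y - y₀)) ∈ dualCone P.K := interior_subset (s := P.Q) ht
  have h2 := (convex_dualCone P.K).combo_interior_self_mem_interior hs₀ h1
    (a := t / (1 + t)) (b := 1 / (1 + t)) (by positivity) (by positivity) (by field_simp; ring)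
  convert h2 using 1
  have e : s₀ = P.c - P.adj y₀ := by rw [← hy₀]; abel
  rw [e, slack, slack]
  simp only [map_add, map_smul, map_sub]
  have h3 : (1 + t) ≠ 0 := by positivity
  match_scalars <;> field_simp <;> ring

omit [FiniteDimensional ℝ E] in
theorem hasFDerivAt_slack (P : Problem E H) (y : H) : HasFDerivAt P.slack (-P.adj) y :=
  P.adj.hasFDerivAt.const_sub P.c

section Derivatives

variable (hF : IsNormalBarrier P.K ν P.F) (hK : IsRegularCone P.K)
  (hstrict : P.StrictlyFeasible)

/-- The point `x(y) ∈ int K` with `∇F(x(y)) = -s(y)`. -/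
def primalPoint (P : Problem E H) (y : H) : E := conjugatePoint P.K P.F (P.slack y)

include hF hK hstrict

theorem primalPoint_mem {y : H} (hy : y ∈ interior P.Q) :
    P.primalPoint y ∈ interior (P.K : Set E) :=
  hF.conjugatePoint_mem hK (slack_mem_interior hstrict hy)

theorem grad_primalPoint {y : H} (hy : y ∈ interior P.Q) :
    grad P.F (P.primalPoint y) = -P.slack y :=
  hF.grad_conjugatePoint hK (slack_mem_interior hstrict hy)

theorem grad_f {y : H} (hy : y ∈ interior P.Q) : grad P.f y = P.A (P.primalPoint y) := by
  have h := (hF.hasFDerivAt_dualBarrier hK (slack_mem_interior hstrict hy)).comp y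
    (hasFDerivAt_slack P y)
  refine (HasFDerivAt.fderiv h).trans ?_
  ext u
  simp [adj_apply, primalPoint]

theorem hess_f {y : H} (hy : y ∈ interior P.Q) :
    hess P.f y = P.A.comp ((hess P.F (P.primalPoint y)).inverse.comp P.adj) := by
  have h := P.A.hasFDerivAt.comp y
    ((hF.hasFDerivAt_conjugatePoint hK (slack_mem_interior hstrict hy)).comp y
      (hasFDerivAt_slack P y))
  refine HasFDerivAt.fderiv ((h.congr_fderiv ?_).congr_of_eventuallyEq ?_)
  · ext u v
    simp [primalPoint]
  · filter_upwards [isOpen_interior.mem_nhds hy] with z hz using grad_f hF hK hstrict hz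

end Derivatives

omit [FiniteDimensional ℝ E] in
theorem adj_injective [FiniteDimensional ℝ H] (hA : Function.Surjective P.A) (y : H)
    (hy : P.adj y = 0) : y = 0 := by
  by_contra hne
  obtain ⟨g, hg⟩ := SeparatingDual.exists_ne_zero (R := ℝ) hne
  obtain ⟨x, hx⟩ := hA g
  apply hg
  rw [← hx, ← adj_apply, hy]
  rfl

/-- The form `A M⁻¹ A^*` for a positive definite `M`. -/
theorem isPD_schur [FiniteDimensional ℝ H] (hA : Function.Surjective P.A)
    {M : E →L[ℝ] StrongDual ℝ E} (hM : IsPD M) : IsPD (P.A.comp (M.inverse.comp P.adj)) := by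
  have e : ∀ u v, P.A.comp (M.inverse.comp P.adj) u v = P.adj v (M.inverse (P.adj u)) :=
    fun u v => rfl
  refine ⟨⟨fun u v => ?_, fun u => ?_⟩, fun u hu => ?_⟩
  · rw [e, e, hM.inverse_symm]
  · rw [e, ← hM.sq_dualNorm]; positivity
  · rw [e, ← hM.sq_dualNorm, hM.dualNorm_eq, hM.sq_primalNorm] at hu
    have h0 := hM.eq_zero _ hu
    apply adj_injective hA
    rw [← hM.apply_inverse (P.adj u), h0, map_zero]

omit [FiniteDimensional ℝ E] in
theorem primalNorm_schur (P : Problem E H) (M : E →L[ℝ] StrongDual ℝ E) (h : H) :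
    primalNorm (P.A.comp (M.inverse.comp P.adj)) h = dualNorm M (P.adj h) := rfl

omit [FiniteDimensional ℝ E] in
/-- A linear function vanishing on the kernel of `A` lies in the range of `A^*`. -/
theorem exists_adj_eq [FiniteDimensional ℝ H] (P : Problem E H) (hA : Function.Surjective P.A)
    {s : StrongDual ℝ E} (hs : ∀ x, P.A x = 0 → s x = 0) : ∃ y, P.adj y = s := by
  obtain ⟨R, hR⟩ := (P.A : E →ₗ[ℝ] StrongDual ℝ H).exists_rightInverse_of_surjective
    (LinearMap.range_eq_top.2 hA)
  have hR' : ∀ g, P.A (R g) = g := fun g => LinearMap.congr_fun hR g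
  refine ⟨(bidualEquiv H).symm ((s : E →ₗ[ℝ] ℝ).comp R).toContinuousLinearMap, ?_⟩
  ext x
  rw [adj_apply, ← bidualEquiv_apply, ContinuousLinearEquiv.apply_symm_apply]
  have h1 : s (R (P.A x) - x) = 0 := hs _ (by rw [map_sub, hR', sub_self])
  rw [map_sub, sub_eq_zero] at h1
  exact h1

/-- The central path exists. -/
theorem isCentralPoint_centralPath [FiniteDimensional ℝ H] (hF : IsNormalBarrier P.K ν P.F)
    (hA : Function.Surjective P.A) (hstrict : P.StrictlyFeasible) {μ : ℝ} (hμ : 0 < μ) :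
    P.IsCentralPoint μ (P.centralPath μ) := by
  apply Classical.epsilon_spec (p := P.IsCentralPoint μ)
  obtain ⟨⟨x₀, hx₀, hAx₀⟩, s₀, hs₀, y₀, hy₀⟩ := hstrict
  -- On `{A x = b}` the costs `c` and `s₀` differ by the constant `⟨b, y₀⟩`. The path point is thus
  -- the minimizer of `⟨s₀, x⟩/μ + F(x)` on this slice, where `s₀` supplies coercivity.
  have hs : μ⁻¹ • s₀ ∈ interior (dualCone P.K) :=
    smul_mem_interior_dualCone P.K hs₀ (inv_pos.2 hμ)
  obtain ⟨x, hx, hxW, hker⟩ := hF.exists_grad_add_apply_eq_zero hs hx₀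
    (LinearMap.ker (P.A : E →ₗ[ℝ] StrongDual ℝ H))
  have hAx : P.A x = P.b := by
    have h : P.A (x - x₀) = 0 := hxW
    rw [map_sub, hAx₀, sub_eq_zero] at h
    exact h
  obtain ⟨y, hy⟩ := P.exists_adj_eq hA (s := s₀ + μ • grad P.F x) fun w hw => by
    have h := hker w hw
    simp only [add_apply, smul_apply, smul_eq_mul] at h ⊢
    have h2 : μ * (grad P.F x w + μ⁻¹ * s₀ w) = s₀ w + μ * grad P.F x w := by
      field_simp; ring
    rw [← h2, h, mul_zero]
  refine ⟨(x, -(μ • grad P.F x), y + y₀), hx, hAx, ?_, rfl⟩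
  rw [map_add, hy, ← hy₀]
  abel

end Problem

/-! ### The predicted point -/

/-- Points whose gradients are close in the dual local norm have close Hessians. -/
theorem IsNormalBarrier.hess_le_of_grad_sub_le {V : Type*} [NormedAddCommGroup V]
    [NormedSpace ℝ V] [FiniteDimensional ℝ V] {K : ProperCone ℝ V} {ν : ℝ} {F : V → ℝ}
    (hF : IsNormalBarrier K ν F) (hK : IsRegularCone K) {x z : V}
    (hx : x ∈ interior (K : Set V)) (hz : z ∈ interior (K : Set V)) {β : ℝ}
    (hβ : β ∈ Icc (0 : ℝ) (1 / 9))
    (h : (grad F z - grad F x) (z - x) ≤ β * dualNorm (hess F x) (grad F z - grad F x)) (u : V) :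
    hess F x u u ≤ ((1 - 2 * β) ^ 3)⁻¹ * hess F z u u ∧
      hess F z u u ≤ ((1 - 2 * β) ^ 3)⁻¹ * hess F x u u := by
  obtain ⟨hβ0, hβ1⟩ := hβ
  have hM := hF.isPD_hess hK hx
  have h1 := hF.selfConcordant.sq_dualNorm_grad_sub_le hx hz hM
  have hxz : x + (z - x) ∈ interior (K : Set V) := by simpa using hz
  have h2 := hF.selfConcordant.grad_sub_ge hx hxz
  have h3 := hF.selfConcordant.hess_add hx hxz
  rw [add_sub_cancel, ← sub_apply] at h2
  rw [add_sub_cancel] at h3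
  have hq := dualNorm_nonneg (hess F x) (grad F z - grad F x)
  have hr := primalNorm_nonneg (hess F x) (z - x)
  set q := dualNorm (hess F x) (grad F z - grad F x)
  set r := primalNorm (hess F x) (z - x)
  -- From `q²/(2(1+q)) ≤ βq` follows `q ≤ 2β/(1 - 2β)`, and `1 - 2β ≥ 7/9`.
  have hqβ : q ≤ 18 / 7 * β := by
    have h4 := h1.trans h
    rw [div_le_iff₀ (by positivity)] at h4
    by_contra! hcon
    have hq0 : 0 < q := by linarith
    have h5 : q ≤ β * (2 * (1 + q)) := by
      by_contra! hc
      nlinarith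
    nlinarith
  -- The value `r = 2β` would already give `4β²/(1 + 2β) ≥ (36/11)β²`, above `(18/7)β²` when `β >
  -- 0`.
  have hrβ : r ≤ 2 * β := by
    have h4 : r ^ 2 / (1 + r) ≤ 18 / 7 * β ^ 2 := by
      have := mul_le_mul_of_nonneg_left hqβ hβ0
      linarith
    rw [div_le_iff₀ (by positivity)] at h4
    by_contra! hcon
    have h5 : β * β * r ≤ 1 / 9 * β * r := by gcongr
    have h6 : β * r * 2 ≤ r * r := by nlinarith
    have h7 : β * β * 4 ≤ r * r := by nlinarith
    nlinarith
  have hpos : 0 < 1 - 2 * β := by linarith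
  obtain ⟨h5, h6⟩ := h3 (by linarith) u
  have hpow : (1 - 2 * β) ^ 3 ≤ (1 - r) ^ 3 := pow_le_pow_left₀ hpos.le (by linarith) 3
  have n1 := hM.nonneg u
  have n2 := (hF.isPD_hess hK hz).nonneg u
  rw [le_inv_mul_iff₀ (pow_pos hpos 3), le_inv_mul_iff₀ (pow_pos hpos 3)]
  exact ⟨(mul_le_mul_of_nonneg_right hpow n1).trans h6,
    (mul_le_mul_of_nonneg_right hpow n2).trans h5⟩

namespace Problem

variable {E H : Type*} [NormedAddCommGroup E] [NormedSpace ℝ E]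
  [NormedAddCommGroup H] [NormedSpace ℝ H] {P : Problem E H} {ν : ℝ}

theorem slack_apply {x : E} (hx : P.A x = P.b) (y : H) : P.slack y x = P.c x - P.b y := by
  rw [slack, sub_apply, adj_apply, hx]

theorem fStar_eq {sStar : StrongDual ℝ E} {yStar : H} (hopt : P.IsDualOptimal sStar yStar) :
    P.fStar = P.b yStar := by
  refine IsGreatest.csSup_eq ⟨⟨yStar, ?_, rfl⟩, ?_⟩
  · show P.slack yStar ∈ dualCone P.K
    rw [slack, ← hopt.1.2, add_sub_cancel_right]
    exact hopt.1.1
  · rintro _ ⟨y, hy, rfl⟩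
    exact hopt.2 _ hy y (by rw [slack, sub_add_cancel])

/-! ### Duality estimates along the central path. -/

namespace IsCentralPoint

variable {μ : ℝ} {z : E × StrongDual ℝ E × H}

theorem slack_eq (hz : P.IsCentralPoint μ z) : P.slack z.2.2 = z.2.1 := by
  rw [slack, ← hz.2.2.1, hz.2.2.2]
  abel

theorem slack_apply_self (hF : IsNormalBarrier P.K ν P.F) (hz : P.IsCentralPoint μ z) :
    P.slack z.2.2 z.1 = μ * ν := by
  rw [hz.slack_eq, hz.2.2.2, neg_apply, smul_apply, hF.grad_self hz.1, smul_eq_mul]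
  ring

theorem grad_scaled (hF : IsNormalBarrier P.K ν P.F) (hμ : 0 < μ) (hz : P.IsCentralPoint μ z) :
    grad P.F (μ⁻¹ • z.1) = -P.slack z.2.2 := by
  rw [hF.grad_smul hz.1 (inv_pos.2 hμ), inv_inv, hz.slack_eq, hz.2.2.2, neg_neg]

theorem slack_mem [FiniteDimensional ℝ E] (hF : IsNormalBarrier P.K ν P.F)
    (hK : IsRegularCone P.K) (hμ : 0 < μ) (hz : P.IsCentralPoint μ z) :
    P.slack z.2.2 ∈ interior (dualCone P.K) := by
  have := hF.neg_grad_mem_interior hK (smul_mem_interior_cone P.K hz.1 (inv_pos.2 hμ))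
  rwa [hz.grad_scaled hF hμ, neg_neg] at this

/-- The norm is at most `⟨s_*, x_μ⟩/μ`, and optimality of `y_*` bounds this by the scaled gap `⟨s_μ,
x_μ⟩/μ = ν`. -/
theorem dualNorm_optimal_le [FiniteDimensional ℝ E] (hF : IsNormalBarrier P.K ν P.F)
    (hK : IsRegularCone P.K) (hμ : 0 < μ) (hz : P.IsCentralPoint μ z)
    {sStar : StrongDual ℝ E} {yStar : H} (hopt : P.IsDualOptimal sStar yStar) :
    dualNorm (hess P.F (μ⁻¹ • z.1)) sStar ≤ ν := by
  refine (hF.dualNorm_le_apply hK hopt.1.1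
    (smul_mem_interior_cone P.K hz.1 (inv_pos.2 hμ))).trans ?_
  have h1 : sStar = P.slack yStar := by rw [slack, ← hopt.1.2, add_sub_cancel_right]
  have h2 := hopt.2 _ (interior_subset (hz.slack_mem hF hK hμ)) z.2.2
    (by rw [slack, sub_add_cancel])
  have h3 := hz.slack_apply_self hF
  rw [slack_apply hz.2.1] at h3
  rw [map_smul, smul_eq_mul, inv_mul_le_iff₀ hμ, h1, slack_apply hz.2.1]
  linarith

/-- The comparison factor is `⟨s_1, x_μ⟩/μ`. Orthogonality of primal and dual differences gives
`⟨s_1, x_μ⟩ + ⟨s_μ, x_1⟩ = (1 + μ)ν`, and the second term is nonnegative. -/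
theorem primalNorm_hess_le [FiniteDimensional ℝ E] (hF : IsNormalBarrier P.K ν P.F)
    (hK : IsRegularCone P.K) (hμ : μ ∈ Ioc (0 : ℝ) 1) (hz : P.IsCentralPoint μ z)
    {z₁ : E × StrongDual ℝ E × H} (hz₁ : P.IsCentralPoint 1 z₁) (v : E) :
    primalNorm (hess P.F z₁.1) v ≤ 2 * ν / μ * primalNorm (hess P.F (μ⁻¹ • z.1)) v := by
  refine (hF.primalNorm_hess_le hz₁.1
    (smul_mem_interior_cone P.K hz.1 (inv_pos.2 hμ.1)) v).trans
    (mul_le_mul_of_nonneg_right ?_ (primalNorm_nonneg _ _))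
  have e1 := hz₁.grad_scaled hF one_pos
  rw [inv_one, one_smul] at e1
  have h1 := hz.slack_apply_self hF
  have h2 := hz₁.slack_apply_self hF
  have h3 := interior_subset (hz.slack_mem hF hK hμ.1) z₁.1 (interior_subset hz₁.1)
  have h4 := mul_le_mul_of_nonneg_right hμ.2 (hF.nonneg hz.1)
  rw [slack_apply hz.2.1] at h1
  rw [slack_apply hz₁.2.1] at h2 h3
  rw [e1, neg_apply, neg_neg, map_smul, smul_eq_mul, slack_apply hz.2.1, div_eq_inv_mul]
  refine mul_le_mul_of_nonneg_left ?_ (inv_pos.2 hμ.1).le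
  linarith

end IsCentralPoint

/-! ### Estimates for the prediction step. -/

section Main

variable [FiniteDimensional ℝ E] [FiniteDimensional ℝ H]
  (hF : IsNormalBarrier P.K ν P.F) (hK : IsRegularCone P.K) (hA : Function.Surjective P.A)
  (hstrict : P.StrictlyFeasible) {sStar : StrongDual ℝ E} {yStar : H}

include hF hK hA hstrict

theorem isPD_hess_f {y : H} (hy : y ∈ interior P.Q) : IsPD (hess P.f y) := by
  rw [hess_f hF hK hstrict hy]
  exact isPD_schur hA (hF.isPD_hess hK (primalPoint_mem hF hK hstrict hy))

theorem isPD_B : IsPD P.B :=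
  hF.isPD_hess hK (isCentralPoint_centralPath hF hA hstrict one_pos).1

/-- The bound for `‖∇²F_*(s(y)) s_*‖_B` in the neighborhood of the central path. -/
theorem primalNorm_B_inverse_hess_le {μ β σ : ℝ} (hopt : P.IsDualOptimal sStar yStar)
    (hμ : μ ∈ Ioc (0 : ℝ) 1) (hβ : β ∈ Icc (0 : ℝ) (1 / 9))
    (hbound : P.BoundedAlongPath sStar σ) {y : H} (hy : y ∈ P.nbhd μ β) :
    primalNorm P.B ((hess P.F (P.primalPoint y)).inverse sStar) ≤
      σ + 24 * ν ^ 2 / μ * β := by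
  have hz := isCentralPoint_centralPath hF hA hstrict hμ.1
  have hz₁ := isCentralPoint_centralPath hF hA hstrict one_pos
  have hbd := hbound μ hμ
  set z := P.centralPath μ
  set x := P.primalPoint y
  have hx : x ∈ interior (P.K : Set E) := primalPoint_mem hF hK hstrict hy.1
  have hgx : grad P.F x = -P.slack y := grad_primalPoint hF hK hstrict hy.1
  set x' := μ⁻¹ • z.1
  have hx' : x' ∈ interior (P.K : Set E) := smul_mem_interior_cone P.K hz.1 (inv_pos.2 hμ.1)
  have hgx' : grad P.F x' = -P.slack z.2.2 := hz.grad_scaled hF hμ.1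
  have hM := hF.isPD_hess hK hx
  have hN := hF.isPD_hess hK hx'
  have hAx' : P.A x' = μ⁻¹ • P.b := by rw [map_smul, hz.2.1]
  have hd : grad P.F x' - grad P.F x = P.adj (z.2.2 - y) := by
    rw [hgx, hgx', slack, slack, map_sub]; abel
  -- Since `A x = ∇f(y)` and `A x' = b/μ`, this pairing equals `⟨∇f(y) - b/μ, y - y_μ⟩`, which is
  -- bounded by the proximity measure times the local norm of `y - y_μ`.
  have hclose : (grad P.F x' - grad P.F x) (x' - x) ≤
      β * dualNorm (hess P.F x) (grad P.F x' - grad P.F x) := by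
    have h1 := (isPD_hess_f hF hK hA hstrict hy.1).apply_le_dualNorm
      (grad P.f y - μ⁻¹ • P.b) (y - z.2.2)
    have h2 : primalNorm (hess P.f y) (y - z.2.2) =
        dualNorm (hess P.F x) (grad P.F x' - grad P.F x) := by
      rw [primalNorm_sub_comm, hess_f hF hK hstrict hy.1, primalNorm_schur, hd]
    have h3 : (grad P.f y - μ⁻¹ • P.b) (y - z.2.2) =
        (grad P.F x' - grad P.F x) (x' - x) := by
      rw [hd, adj_apply, grad_f hF hK hstrict hy.1, ← hAx', map_sub P.A]
      simp only [sub_apply, map_sub]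
      ring
    rw [h2, h3] at h1
    exact h1.trans (mul_le_mul_of_nonneg_right hy.2 (dualNorm_nonneg _ _))
  have hcmp := hF.hess_le_of_grad_sub_le hK hx hx' hβ hclose
  obtain ⟨hβ0, hβ1⟩ := hβ
  have hpos : 0 < (1 - 2 * β) ^ 3 := pow_pos (by linarith) 3
  have hθ : 1 ≤ ((1 - 2 * β) ^ 3)⁻¹ :=
    (one_le_inv₀ hpos).2 (pow_le_one₀ (by linarith) (by linarith))
  -- Equivalent to `(1 - 2β)³(1 + 12β) ≥ 1`, valid on `[0, 1/9]`.
  have hθ' : ((1 - 2 * β) ^ 3)⁻¹ - 1 ≤ 12 * β := by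
    rw [sub_le_iff_le_add, inv_le_iff_one_le_mul₀ hpos]
    have h1 : 0 ≤ β * (1 / 9 - β) := mul_nonneg hβ0 (by linarith)
    have h2 : 0 ≤ β ^ 2 * (1 / 9 - β) := mul_nonneg (sq_nonneg β) (by linarith)
    have h3 : 0 ≤ β ^ 3 * (1 / 9 - β) := mul_nonneg (pow_nonneg hβ0 3) (by linarith)
    nlinarith
  have h1 := hM.primalNorm_inverse_sub_le hN hθ (fun u => (hcmp u).1) (fun u => (hcmp u).2) sStar
  have h2 := hz.dualNorm_optimal_le hF hK hμ.1 hopt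
  have h3 := hz.primalNorm_hess_le hF hK hμ hz₁
    ((hess P.F x).inverse sStar - (hess P.F x').inverse sStar)
  have h4 : hessDual P.FStar z.2.1 = (hess P.F x').inverse := by
    have hmem := hz.slack_mem hF hK hμ.1
    rw [← hz.slack_eq]
    refine (hF.hessDual_dualBarrier hK hmem).trans ?_
    rw [← hF.eq_conjugatePoint hK hx' hgx']
  rw [h4] at hbd
  have hν := hF.nonneg hx
  have hB := isPD_B hF hK hA hstrict
  have h5 := hB.primalNorm_add_le ((hess P.F x').inverse sStar)
    ((hess P.F x).inverse sStar - (hess P.F x').inverse sStar)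
  rw [add_sub_cancel] at h5
  have h6 : primalNorm (hess P.F x')
      ((hess P.F x).inverse sStar - (hess P.F x').inverse sStar) ≤ 12 * β * ν :=
    h1.trans (mul_le_mul hθ' h2 (dualNorm_nonneg _ _) (by positivity))
  have h7 : 2 * ν / μ * primalNorm (hess P.F x')
      ((hess P.F x).inverse sStar - (hess P.F x').inverse sStar) ≤ 2 * ν / μ * (12 * β * ν) :=
    mul_le_mul_of_nonneg_left h6 (div_nonneg (by positivity) hμ.1.le)
  have h8 : 2 * ν / μ * (12 * β * ν) = 24 * ν ^ 2 / μ * β := by ring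
  have h9 : primalNorm P.B ((hess P.F x).inverse sStar - (hess P.F x').inverse sStar) ≤ _ := h3
  linarith

/-- By sharpness of the dual maximum, the `G`-norm is dominated by the local norm. -/
theorem primalNorm_G_le {γ : ℝ} (hopt : P.IsDualOptimal sStar yStar)
    (hsharp : P.SharpDual yStar γ) {y : H} (hy : y ∈ interior P.Q) (h : H) :
    γ * primalNorm P.G h ≤ P.b (yStar - y) * primalNorm (hess P.f y) h := by
  have hG : IsPD P.G := isPD_schur hA (isPD_B hF hK hA hstrict)
  have hN := isPD_hess_f hF hK hA hstrict hy
  have hmem : ∀ w, hess P.f y w w < 1 → y + w ∈ P.Q := fun w hw => by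
    have h1 : dualNorm (hess P.F (P.primalPoint y)) (-P.adj w) ≤ 1 := by
      rw [← map_neg, ← primalNorm_schur, ← hess_f hF hK hstrict hy]
      refine Real.sqrt_le_one.2 ?_
      simpa using hw.le
    have h2 := hF.neg_grad_add_mem_dualCone hK (primalPoint_mem hF hK hstrict hy) h1
    rw [grad_primalPoint hF hK hstrict hy, neg_neg] at h2
    show P.slack (y + w) ∈ dualCone P.K
    convert h2 using 1
    rw [slack, slack, map_add]
    abel
  -- Sharpness is used at both `y + w` and `y - w`: the terms `⟨b, w⟩` cancel in the sum, and the
  -- triangle inequality leaves `2‖w‖_G`.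
  have hball : ∀ w, hess P.f y w w < 1 → γ * primalNorm P.G w ≤ P.b (yStar - y) := fun w hw => by
    have h1 := hsharp.2 _ (hmem w hw)
    have h2 := hsharp.2 _ (hmem (-w) (by simpa using hw))
    rw [fStar_eq hopt] at h1 h2
    have h3 := hG.primalNorm_add_le (y + w - yStar) (yStar - (y + -w))
    have h4 : y + w - yStar + (yStar - (y + -w)) = (2 : ℝ) • w := by module
    rw [h4, primalNorm_smul, abs_of_pos two_pos, primalNorm_sub_comm P.G yStar] at h3
    have h5 := mul_le_mul_of_nonneg_left h3 hsharp.1.le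
    simp only [map_add, map_neg, map_sub] at h1 h2 ⊢
    linarith
  have h1 := hN.le_mul_primalNorm ((γ : ℝ) • P.G h) (C := primalNorm P.G h * P.b (yStar - y))
    (fun w hw => by
      have h2 := mul_le_mul_of_nonneg_left (hG.apply_le h w) hsharp.1.le
      have h3 := mul_le_mul_of_nonneg_left (hball w hw) (primalNorm_nonneg P.G h)
      rw [smul_apply, smul_eq_mul]
      linarith) h
  rw [smul_apply, smul_eq_mul, ← hG.sq_primalNorm] at h1
  have h2 := primalNorm_nonneg P.G h
  rcases h2.eq_or_lt with h0 | h0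
  · rw [← h0, mul_zero]
    refine mul_nonneg ?_ (primalNorm_nonneg _ _)
    have := hball 0 (by simp)
    exact (mul_nonneg hsharp.1.le (primalNorm_nonneg _ _)).trans this
  · by_contra! hcon
    nlinarith

theorem hess_f_pred_sub (hopt : P.IsDualOptimal sStar yStar) {y : H} (hy : y ∈ interior P.Q) :
    hess P.f y (P.pred y - yStar) = P.A ((hess P.F (P.primalPoint y)).inverse sStar) := by
  have hN := isPD_hess_f hF hK hA hstrict hy
  have hx := primalPoint_mem hF hK hstrict hy
  have hM := hF.isPD_hess hK hx
  have e1 : P.pred y - yStar = (hess P.f y).inverse (grad P.f y) + (y - yStar) := by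
    rw [pred]; abel
  have e2 : sStar = P.slack y + P.adj (y - yStar) := by
    rw [map_sub, slack, ← hopt.1.2]; abel
  have e3 : (hess P.F (P.primalPoint y)).inverse (P.slack y) = P.primalPoint y := by
    have := hF.hess_self hx
    rw [grad_primalPoint hF hK hstrict hy, neg_neg] at this
    rw [← this, hM.inverse_apply]
  rw [e1, map_add, hN.apply_inverse, grad_f hF hK hstrict hy, hess_f hF hK hstrict hy]
  conv_rhs => rw [e2, map_add, e3, map_add]
  rfl

/-- Squaring the sharpness bound for `w` and inserting `‖w‖_y² ≤ ‖w‖_G ‖v‖_B` leaves one factor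
`‖w‖_G` to cancel. -/
theorem primalNorm_G_pred_sub_le {γ : ℝ} (hopt : P.IsDualOptimal sStar yStar)
    (hsharp : P.SharpDual yStar γ) {y : H} (hy : y ∈ interior P.Q) :
    primalNorm P.G (P.pred y - yStar) ≤ (P.b (y - yStar)) ^ 2 / γ ^ 2 *
      primalNorm P.B ((hess P.F (P.primalPoint y)).inverse sStar) := by
  have hB := isPD_B hF hK hA hstrict
  have hN := isPD_hess_f hF hK hA hstrict hy
  have h1 := primalNorm_G_le hF hK hA hstrict hopt hsharp hy (P.pred y - yStar)
  have h2 := hess_f_pred_sub hF hK hA hstrict hopt hy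
  set w := P.pred y - yStar
  set v := (hess P.F (P.primalPoint y)).inverse sStar
  have h3 : hess P.f y w w ≤ primalNorm P.G w * primalNorm P.B v := by
    rw [h2, ← adj_apply]
    exact hB.apply_le_dualNorm _ _
  have hγ := hsharp.1
  have n1 := primalNorm_nonneg P.G w
  have n2 := primalNorm_nonneg P.B v
  have h4 : γ ^ 2 * primalNorm P.G w ^ 2 ≤
      P.b (y - yStar) ^ 2 * (primalNorm P.G w * primalNorm P.B v) := by
    have h5 := pow_le_pow_left₀ (mul_nonneg hγ.le n1) h1 2
    rw [mul_pow, mul_pow, hN.sq_primalNorm] at h5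
    have h6 : P.b (yStar - y) ^ 2 = P.b (y - yStar) ^ 2 := by
      rw [map_sub, map_sub]; ring
    rw [h6] at h5
    exact h5.trans (mul_le_mul_of_nonneg_left h3 (sq_nonneg _))
  rw [div_mul_eq_mul_div, le_div_iff₀ (by positivity)]
  rcases n1.eq_or_lt with h0 | h0
  · rw [← h0, zero_mul]; positivity
  · by_contra! hcon
    nlinarith

theorem sq_b_apply_le (h : H) : P.b h ^ 2 ≤ ν * primalNorm P.G h ^ 2 := by
  have hz := isCentralPoint_centralPath hF hA hstrict one_pos
  have hB := isPD_B hF hK hA hstrict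
  have hG : IsPD P.G := isPD_schur hA hB
  have h1 := hB.sq_apply_le (P.B.inverse (P.adj h)) (P.centralPath 1).1
  rw [hB.apply_inverse, adj_apply, hz.2.1] at h1
  have h2 : P.B (P.centralPath 1).1 (P.centralPath 1).1 = ν := hF.hess_self_self hz.1
  rw [h2] at h1
  rw [hG.sq_primalNorm]
  exact h1.trans_eq (mul_comm _ _)

end Main

end Problem

end ConicIPM

end

theorem mainTheorem3
    {E H : Type*} [NormedAddCommGroup E] [NormedSpace ℝ E] [FiniteDimensional ℝ E]
    [NormedAddCommGroup H] [NormedSpace ℝ H] [FiniteDimensional ℝ H]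
    (P : ConicIPM.Problem E H) (ν : ℝ)
    (hK : ConicIPM.IsRegularCone P.K)
    (hF : ConicIPM.IsNormalBarrier P.K ν P.F)
    (hA : Function.Surjective P.A)
    (hstrict : P.StrictlyFeasible)
    (sStar : StrongDual ℝ E) (yStar : H) (hopt : P.IsDualOptimal sStar yStar)
    (γd σd : ℝ)
    (hsharp : P.SharpDual yStar γd)
    (hbound : P.BoundedAlongPath sStar σd)
    (μ β : ℝ) (hμ : μ ∈ Set.Ioc (0 : ℝ) 1) (hβ : β ∈ Set.Icc (0 : ℝ) (1 / 9))
    (y : H) (hy : y ∈ P.nbhd μ β) :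
    (ConicIPM.hess P.f y).IsInvertible ∧
    ConicIPM.primalNorm P.G (P.pred y - yStar)
      ≤ 4 / γd ^ 2 * (σd + 6 * ν ^ 2 / μ * β) * (P.b (y - yStar)) ^ 2 ∧
    4 / γd ^ 2 * (σd + 6 * ν ^ 2 / μ * β) * (P.b (y - yStar)) ^ 2
      ≤ 4 * ν / γd ^ 2 * (σd + 6 * ν ^ 2 / μ * β)
          * ConicIPM.primalNorm P.G (y - yStar) ^ 2 := by
  have hσ : 0 ≤ σd := (ConicIPM.primalNorm_nonneg _ _).trans (hbound μ hμ)
  have hμ0 := hμ.1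
  have hβ0 := hβ.1
  have hγ := hsharp.1
  refine ⟨(ConicIPM.Problem.isPD_hess_f hF hK hA hstrict hy.1).isInvertible, ?_, ?_⟩
  · have h1 := ConicIPM.Problem.primalNorm_G_pred_sub_le hF hK hA hstrict hopt hsharp hy.1
    have h2 := ConicIPM.Problem.primalNorm_B_inverse_hess_le hF hK hA hstrict hopt hμ hβ hbound hy
    refine (h1.trans (mul_le_mul_of_nonneg_left (h2.trans ?_) (by positivity))).trans_eq
      (b := (P.b (y - yStar)) ^ 2 / γd ^ 2 * (4 * (σd + 6 * ν ^ 2 / μ * β))) (by ring)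
    -- The factor 4 comes from `24 = 4 · 6`; the term `σ_d` is simply enlarged to `4σ_d`, using `σ_d
    -- ≥ 0`.
    have h3 : 24 * ν ^ 2 / μ * β = 4 * (6 * ν ^ 2 / μ * β) := by ring
    linarith
  · have h1 := ConicIPM.Problem.sq_b_apply_le hF hK hA hstrict (y - yStar)
    refine (mul_le_mul_of_nonneg_left h1 (by positivity)).trans_eq (by ring)
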